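/- Let $d\ge 1$ and let $\Omega\subset\mathbb R^d$ be a bounded domain with Lipschitz boundary $\Gamma$. Write $\langle f,g\rangle_\Omega=\int_\Omega f\overline g\,dx$ and $\langle f,g\rangle_\Gamma=\int_\Gamma f\overline g\,dS$, and let $\operatorname{tr}$ be the Dirichlet trace, i.e. the extension by continuity of $\varphi\mapsto\varphi|_\Gamma$ from $C^\infty(\overline\Omega)$ to $H^s(\Omega)$, $s>1/2$, with values in $L^2(\Gamma)$. Let $\mathfrak b:D(\mathfrak b)\times D(\mathfrak b)\to\mathbb C$ be an admissible form on $L^2(\Omega)$. That is, $\mathfrak b$ is a symmetric sesquilinear form which is generating: densely defined, semi-bounded, continuous ($|\mathfrak b(u,v)|\le M\|u\|_{\mathfrak b}\|v\|_{\mathfrak b}$) and closed ($(D(\mathfrak b),\|\cdot\|_{\mathfrak b})$ is complete), where $\|u\|_{\mathfrak b}^2=\operatorname{Re}\mathfrak b(u,u)+(1-\lambda_{\mathfrak b})\|u\|_\Omega^2$ and $\lambda_{\mathfrak b}$ is the largest real $\lambda$ with $\operatorname{Re}\mathfrak b(u,u)\ge\lambda\|u\|_\Omega^2$ for all $u\in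 D(\mathfrak b)$; and, for some $\rho\in(0,1)$, $C_c^\infty(\Omega)\subseteq (D(\mathfrak b),\|\cdot\|_{\mathfrak b})\subseteq H^{1/2+\rho}(\Omega)$, the latter embedding being continuous and dense. Let $B_N$ be the operator associated to $\mathfrak b$ (so $u\in D(B_N)$ and $B_Nu=f$ if and only if $u\in D(\mathfrak b)$ and $\mathfrak b(u,v)=\langle f,v\rangle_\Omega$ for all $v\in D(\mathfrak b)$), and let $B_D$ be the operator associated to the restriction of $\mathfrak b$ to $\{u\in D(\mathfrak b):\operatorname{tr}u=0\}$. Assume that $D(B_D)\cap D(B_N)$ is dense in $L^2(\Omega)$, and put $B_0=B_N|_{D(B_D)\cap D(B_N)}$. Define $N^{\mathfrak b}$ and $\mathscr N^{\mathfrak b}$ from $L^2(\Omega)$ to $L^2(\Gamma)$ as follows: - $u\in D(N^{\mathfrak b})$ and $N^{\mathfrak b}u=g$ if $u\in D(\mathfrak b)\cap D(B_0^*)$, $g\in L^2(\Gamma)$ and $\langle B_0^*u,v\rangle_\Omega-\mathfrak b(u,v)=\langle g,\operatorname{tr}v\rangle_\Gamma$ for all $v\in D(\mathfrak b)$; - $u\in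 D(\mathscr N^{\mathfrak b})$ and $\mathscr N^{\mathfrak b}u=g$ if $u\in D(B_0^*)$, $g\in L^2(\Gamma)$ and $\langle B_0^*u,v\rangle_\Omega-\langle u,B_Nv\rangle_\Omega=\langle g,\operatorname{tr}v\rangle_\Gamma$ for all $v\in D(B_N)$. Then: (i) $B_0$ is densely defined, symmetric and closed; $B_0^*$ is densely defined, $B_0\subseteq B_0^*$ and $B_0^{**}=B_0$. (ii) $\operatorname{tr}(D(B_N))$ is dense in $L^2(\Gamma)$. (iii) $N^{\mathfrak b}$ and $\mathscr N^{\mathfrak b}$ are well-defined linear operators (every $v\in D(\mathfrak b)$ has exactly one trace, and the element $g$ above is unique in both cases), $\mathscr N^{\mathfrak b}|_{D(\mathfrak b)\cap D(\mathscr N^{\mathfrak b})}=N^{\mathfrak b}$, $\ker N^{\mathfrak b}=\ker\mathscr N^{\mathfrak b}=D(B_N)$, and both operators are densely defined. (iv) If $N^{\mathfrak b}$ is surjective, then $N^{\mathfrak b}=\mathscr N^{\mathfrak b}$. -/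

import Mathlib

open MeasureTheory Filter Topology Set
open scoped ENNReal NNReal SchwartzMap FourierTransform ComplexConjugate InnerProductSpace

noncomputable section

namespace AbstractNeumann

/-! ### Bounded Lipschitz domains and the spaces `L²(Ω)`, `L²(Γ)` -/

/-- Euclidean space `ℝ^d`. -/
abbrev Eucl (d : ℕ) : Type := EuclideanSpace ℝ (Fin d)

/-- A bounded domain with Lipschitz boundary: near every boundary point, `Ω` is the part of space
that lies strictly above the graph of a Lipschitz function, in some orthonormal coordinates whose
last axis is `e`. (`x - ⟪e, x⟫ e` is the projection of `x` to the hyperplane orthogonal to `e`;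
only the values of `h` on that hyperplane matter.) -/
structure IsBoundedLipschitzDomain {d : ℕ} (Ω : Set (Eucl d)) : Prop where
  isOpen : IsOpen Ω
  isConnected : IsConnected Ω
  isBounded : Bornology.IsBounded Ω
  exists_graph : ∀ p ∈ frontier Ω, ∃ (U : Set (Eucl d)) (e : Eucl d) (h : Eucl d → ℝ) (K : ℝ≥0),
    IsOpen U ∧ p ∈ U ∧ ‖e‖ = 1 ∧ LipschitzWith K h ∧
      ∀ x ∈ U, x ∈ Ω ↔ h (x - (inner ℝ e x : ℝ) • e) < inner ℝ e x

/-- The surface measure on `Γ = ∂Ω`: the `(d-1)`-dimensional Hausdorff measure, normalised so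
that it is Lebesgue measure on hyperplanes, restricted to the boundary. -/
def surfaceMeasure {d : ℕ} (Ω : Set (Eucl d)) : Measure (Eucl d) :=
  (Measure.euclideanHausdorffMeasure (d - 1)).restrict (frontier Ω)

/-- The complex Hilbert space `L²(Ω)`. -/
abbrev L2Dom {d : ℕ} (Ω : Set (Eucl d)) : Type :=
  Lp ℂ 2 ((volume : Measure (Eucl d)).restrict Ω)

/-- The complex Hilbert space `L²(Γ)`. -/
abbrev L2Bdry {d : ℕ} (Ω : Set (Eucl d)) : Type := Lp ℂ 2 (surfaceMeasure Ω)

/-- The inner product `⟨f, g⟩ = ∫ f * conj g`, linear in the first argument. -/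
abbrev ip {H : Type*} [NormedAddCommGroup H] [InnerProductSpace ℂ H] (f g : H) : ℂ :=
  inner ℂ g f

/-! ### Sobolev spaces of fractional order -/

/-- The norm of `U ∈ L²(ℝ^d)` in `H^s(ℝ^d)`, `s ≥ 0`; it is `∞` if `U ∉ H^s(ℝ^d)`. -/
def sobolevENorm {d : ℕ} (s : ℝ) (U : Lp ℂ 2 (volume : Measure (Eucl d))) : ℝ≥0∞ :=
  eLpNorm (fun ξ : Eucl d => ((1 + ‖ξ‖ ^ 2) ^ (s / 2) : ℝ) • (𝓕 U) ξ) 2 volume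

/-- The norm of `u` in `H^s(Ω)`, `s ≥ 0`, the space of restrictions to `Ω` of elements of
`H^s(ℝ^d)`: the infimum of the norms of all extensions. It is `∞` if `u ∉ H^s(Ω)`. -/
def sobolevENormOn {d : ℕ} (Ω : Set (Eucl d)) (s : ℝ) (u : Eucl d → ℂ) : ℝ≥0∞ :=
  ⨅ (U : Lp ℂ 2 (volume : Measure (Eucl d))) (_ : U =ᵐ[volume.restrict Ω] u), sobolevENorm s U

theorem sobolevENorm_mono {d : ℕ} {s t : ℝ} (hst : s ≤ t)
    (U : Lp ℂ 2 (volume : Measure (Eucl d))) : sobolevENorm s U ≤ sobolevENorm t U := by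
  refine eLpNorm_mono fun ξ => ?_
  have h1 : (1 : ℝ) ≤ 1 + ‖ξ‖ ^ 2 := by nlinarith [sq_nonneg ‖ξ‖]
  rw [norm_smul, norm_smul, Real.norm_of_nonneg (by positivity), Real.norm_of_nonneg (by positivity)]
  gcongr

theorem sobolevENorm_add_le {d : ℕ} (s : ℝ) (U V : Lp ℂ 2 (volume : Measure (Eucl d))) :
    sobolevENorm s (U + V) ≤ sobolevENorm s U + sobolevENorm s V := by
  have hm : ∀ W : Lp ℂ 2 (volume : Measure (Eucl d)), AEStronglyMeasurable
      (fun ξ : Eucl d => ((1 + ‖ξ‖ ^ 2) ^ (s / 2) : ℝ) • (𝓕 W) ξ) volume := fun W => by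
    have hc : Continuous fun ξ : Eucl d => ((1 + ‖ξ‖ ^ 2) ^ (s / 2) : ℝ) :=
      Continuous.rpow_const (by fun_prop) fun ξ => Or.inl (by positivity)
    exact hc.aestronglyMeasurable.smul (Lp.aestronglyMeasurable (𝓕 W))
  refine le_trans (le_of_eq ?_) (eLpNorm_add_le (hm U) (hm V) (by norm_num))
  refine eLpNorm_congr_ae ?_
  have h2 : 𝓕 (U + V) = 𝓕 U + 𝓕 V := FourierTransform.fourier_add U V
  rw [h2]
  filter_upwards [Lp.coeFn_add (𝓕 U) (𝓕 V)] with ξ hξ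
  rw [hξ, Pi.add_apply, Pi.add_apply, smul_add]

theorem sobolevENorm_smul {d : ℕ} (s : ℝ) (c : ℂ) (U : Lp ℂ 2 (volume : Measure (Eucl d))) :
    sobolevENorm s (c • U) = ‖c‖ₑ * sobolevENorm s U := by
  unfold sobolevENorm
  rw [← eLpNorm_const_smul]
  refine eLpNorm_congr_ae ?_
  have h2 : 𝓕 (c • U) = c • 𝓕 U := FourierTransform.fourier_smul c U
  rw [h2]
  filter_upwards [Lp.coeFn_smul c (𝓕 U)] with ξ hξ
  simp only [hξ, Pi.smul_apply]
  exact smul_comm _ _ _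

theorem sobolevENormOn_congr {d : ℕ} {Ω : Set (Eucl d)} (s : ℝ) {u v : Eucl d → ℂ}
    (h : u =ᵐ[volume.restrict Ω] v) : sobolevENormOn Ω s u = sobolevENormOn Ω s v := by
  unfold sobolevENormOn
  congr 1; ext U
  have : (U =ᵐ[volume.restrict Ω] u) ↔ (U =ᵐ[volume.restrict Ω] v) :=
    ⟨fun k => k.trans h, fun k => k.trans h.symm⟩
  simp only [this]

theorem sobolevENormOn_mono {d : ℕ} (Ω : Set (Eucl d)) {s t : ℝ} (hst : s ≤ t)
    (u : Eucl d → ℂ) : sobolevENormOn Ω s u ≤ sobolevENormOn Ω t u :=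
  iInf₂_mono fun U _ => sobolevENorm_mono hst U

theorem sobolevENormOn_add_le {d : ℕ} (Ω : Set (Eucl d)) (s : ℝ) (u v : Eucl d → ℂ) :
    sobolevENormOn Ω s (u + v) ≤ sobolevENormOn Ω s u + sobolevENormOn Ω s v := by
  unfold sobolevENormOn
  simp only [ENNReal.iInf_add, ENNReal.add_iInf, le_iInf_iff]
  intro V hV U hU
  refine (iInf₂_le (U + V) ?_).trans (sobolevENorm_add_le s U V)
  exact EventuallyEq.trans (ae_restrict_of_ae (Lp.coeFn_add U V)) (hU.add hV)

theorem sobolevENormOn_smul_le {d : ℕ} (Ω : Set (Eucl d)) (s : ℝ) (c : ℂ) (u : Eucl d → ℂ) :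
    sobolevENormOn Ω s (c • u) ≤ ‖c‖ₑ * sobolevENormOn Ω s u := by
  rcases eq_or_ne c 0 with rfl | hc
  · refine (iInf₂_le (0 : Lp ℂ 2 (volume : Measure (Eucl d))) ?_).trans ?_
    · filter_upwards [ae_restrict_of_ae (Lp.coeFn_zero ℂ 2 (volume : Measure (Eucl d)))] with x hx
      rw [hx, Pi.smul_apply, zero_smul, Pi.zero_apply]
    · have h0 := sobolevENorm_smul s 0 (0 : Lp ℂ 2 (volume : Measure (Eucl d)))
      rw [zero_smul, enorm_zero, zero_mul] at h0
      rw [h0]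
      exact zero_le
  · unfold sobolevENormOn
    simp only [ENNReal.mul_iInf' (fun h => absurd h enorm_ne_top)
      (fun h => absurd (enorm_eq_zero.mp h) hc)]
    refine le_iInf₂ fun U hU => ?_
    rw [← sobolevENorm_smul]
    exact iInf₂_le (c • U) (EventuallyEq.trans (ae_restrict_of_ae (Lp.coeFn_smul c U))
      (hU.const_smul c))

/-! ### The Dirichlet trace -/

/-- `g = tr u`. The Dirichlet trace is the extension by continuity to `H^s(Ω)`, `s > 1/2`, of the
restriction `φ ↦ φ|_Γ` of functions `φ` that are smooth up to the boundary (for bounded `Ω`, the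
restrictions to the closure of `Ω` of Schwartz functions on `ℝ^d`): `u` is a limit in `H^s(Ω)` of
such functions whose boundary values converge to `g` in `L²(Γ)`. -/
def HasTrace {d : ℕ} (Ω : Set (Eucl d)) (u : L2Dom Ω) (g : L2Bdry Ω) : Prop :=
  ∃ s : ℝ, 1 / 2 < s ∧ ∃ φ : ℕ → 𝓢(Eucl d, ℂ),
    Tendsto (fun n => sobolevENormOn Ω s (fun x => φ n x - u x)) atTop (𝓝 0) ∧
    Tendsto (fun n => eLpNorm (fun x => φ n x - g x) 2 (surfaceMeasure Ω)) atTop (𝓝 0)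

theorem HasTrace.add {d : ℕ} {Ω : Set (Eucl d)} {u u' : L2Dom Ω} {g g' : L2Bdry Ω}
    (h : HasTrace Ω u g) (h' : HasTrace Ω u' g') : HasTrace Ω (u + u') (g + g') := by
  obtain ⟨s, hs, φ, h1, h2⟩ := h
  obtain ⟨s', hs', φ', h1', h2'⟩ := h'
  refine ⟨min s s', lt_min hs hs', fun n => φ n + φ' n, ?_, ?_⟩
  · refine tendsto_of_tendsto_of_tendsto_of_le_of_le tendsto_const_nhds
      (by simpa using h1.add h1') (fun _ => zero_le) fun n => ?_
    calc sobolevENormOn Ω (min s s') (fun x => (φ n + φ' n) x - (u + u' : L2Dom Ω) x)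
        = sobolevENormOn Ω (min s s') ((fun x => φ n x - u x) + fun x => φ' n x - u' x) := by
          refine sobolevENormOn_congr _ ?_
          filter_upwards [Lp.coeFn_add u u'] with x hx
          rw [hx, Pi.add_apply, Pi.add_apply, add_apply]; ring
      _ ≤ _ := sobolevENormOn_add_le _ _ _ _
      _ ≤ _ := add_le_add (sobolevENormOn_mono _ (min_le_left _ _) _)
          (sobolevENormOn_mono _ (min_le_right _ _) _)
  · refine tendsto_of_tendsto_of_tendsto_of_le_of_le tendsto_const_nhds
      (by simpa using h2.add h2') (fun _ => zero_le) fun n => ?_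
    calc eLpNorm (fun x => (φ n + φ' n) x - (g + g' : L2Bdry Ω) x) 2 (surfaceMeasure Ω)
        = eLpNorm ((fun x => φ n x - g x) + fun x => φ' n x - g' x) 2 (surfaceMeasure Ω) := by
          refine eLpNorm_congr_ae ?_
          filter_upwards [Lp.coeFn_add g g'] with x hx
          rw [hx, Pi.add_apply, Pi.add_apply, add_apply]; ring
      _ ≤ _ := eLpNorm_add_le
        ((φ n).continuous.aestronglyMeasurable.sub (Lp.aestronglyMeasurable g))
        ((φ' n).continuous.aestronglyMeasurable.sub (Lp.aestronglyMeasurable g')) (by norm_num)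

theorem HasTrace.smul {d : ℕ} {Ω : Set (Eucl d)} {u : L2Dom Ω} {g : L2Bdry Ω}
    (h : HasTrace Ω u g) (c : ℂ) : HasTrace Ω (c • u) (c • g) := by
  obtain ⟨s, hs, φ, h1, h2⟩ := h
  refine ⟨s, hs, fun n => c • φ n, ?_, ?_⟩
  · refine tendsto_of_tendsto_of_tendsto_of_le_of_le tendsto_const_nhds
      (by simpa using ENNReal.Tendsto.const_mul h1 (Or.inr (enorm_ne_top (x := c))))
      (fun _ => zero_le) fun n => ?_
    calc sobolevENormOn Ω s (fun x => (c • φ n) x - (c • u : L2Dom Ω) x)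
        = sobolevENormOn Ω s (c • fun x => φ n x - u x) := by
          refine sobolevENormOn_congr _ ?_
          filter_upwards [Lp.coeFn_smul c u] with x hx
          rw [hx, Pi.smul_apply, Pi.smul_apply, smul_apply, smul_sub]
      _ ≤ _ := sobolevENormOn_smul_le _ _ _ _
  · refine tendsto_of_tendsto_of_tendsto_of_le_of_le tendsto_const_nhds
      (by simpa using ENNReal.Tendsto.const_mul h2 (Or.inr (enorm_ne_top (x := c))))
      (fun _ => zero_le) fun n => ?_
    calc eLpNorm (fun x => (c • φ n) x - (c • g : L2Bdry Ω) x) 2 (surfaceMeasure Ω)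
        = eLpNorm (c • fun x => φ n x - g x) 2 (surfaceMeasure Ω) := by
          refine eLpNorm_congr_ae ?_
          filter_upwards [Lp.coeFn_smul c g] with x hx
          rw [hx, Pi.smul_apply, Pi.smul_apply, smul_apply, smul_sub]
      _ ≤ _ := (eLpNorm_const_smul _ _ _ _).le

theorem HasTrace.zero {d : ℕ} (Ω : Set (Eucl d)) : HasTrace Ω 0 0 := by
  refine ⟨1, by norm_num, fun _ => 0, ?_, ?_⟩
  · refine tendsto_of_tendsto_of_tendsto_of_le_of_le tendsto_const_nhds
      (tendsto_const_nhds (x := (0 : ℝ≥0∞))) (fun _ => zero_le) fun n => ?_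
    calc sobolevENormOn Ω 1 (fun x => (0 : 𝓢(Eucl d, ℂ)) x - (0 : L2Dom Ω) x)
        = sobolevENormOn Ω 1 ((0 : ℂ) • (0 : Eucl d → ℂ)) := by
          refine sobolevENormOn_congr _ ?_
          filter_upwards [Lp.coeFn_zero ℂ 2 ((volume : Measure (Eucl d)).restrict Ω)] with x hx
          rw [hx]; simp
      _ ≤ _ := sobolevENormOn_smul_le _ _ _ _
      _ = 0 := by simp
  · refine tendsto_const_nhds.congr fun n => ?_
    symm
    calc eLpNorm (fun x => (0 : 𝓢(Eucl d, ℂ)) x - (0 : L2Bdry Ω) x) 2 (surfaceMeasure Ω)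
        = eLpNorm (0 : Eucl d → ℂ) 2 (surfaceMeasure Ω) := by
          refine eLpNorm_congr_ae ?_
          filter_upwards [Lp.coeFn_zero ℂ 2 (surfaceMeasure Ω)] with x hx
          rw [hx]; simp
      _ = 0 := eLpNorm_zero

/-- The space of all `u` with `tr u = 0`. -/
def traceKer {d : ℕ} (Ω : Set (Eucl d)) : Submodule ℂ (L2Dom Ω) where
  carrier := {u | HasTrace Ω u 0}
  add_mem' h h' := by simpa using HasTrace.add h h'
  zero_mem' := HasTrace.zero Ω
  smul_mem' c u h := by simpa using HasTrace.smul h c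

/-! ### Sesquilinear forms and associated operators -/

section Forms

variable {H : Type*} [NormedAddCommGroup H] [InnerProductSpace ℂ H]

/-- A sesquilinear form `b : D(b) × D(b) → ℂ`, defined on a subspace `D(b)` of `H`, linear in the
first and conjugate linear in the second argument. -/
structure SesqForm (H : Type*) [NormedAddCommGroup H] [InnerProductSpace ℂ H] where
  dom : Submodule ℂ H
  toFun : dom →ₗ[ℂ] dom →ₗ⋆[ℂ] ℂ

namespace SesqForm

/-- The form is symmetric. -/
def IsSymm (b : SesqForm H) : Prop := ∀ u v : b.dom, b.toFun u v = conj (b.toFun v u)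

/-- The set of semi-bounds: all real `l` with `Re b(u,u) ≥ l ‖u‖²` on `D(b)`. -/
def semiBounds (b : SesqForm H) : Set ℝ :=
  {l | ∀ u : b.dom, l * ‖(u : H)‖ ^ 2 ≤ (b.toFun u u).re}

/-- The maximal semi-bound. -/
def maxSemiBound (b : SesqForm H) : ℝ := sSup b.semiBounds

/-- The form norm, `‖u‖_b² = Re b(u,u) + (1 - l) ‖u‖²` with `l` the maximal semi-bound. -/
def formNorm (b : SesqForm H) (u : b.dom) : ℝ :=
  √((b.toFun u u).re + (1 - b.maxSemiBound) * ‖(u : H)‖ ^ 2)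

/-- A generating form: densely defined, semi-bounded, continuous and closed. -/
structure IsGenerating (b : SesqForm H) : Prop where
  dense : Dense (b.dom : Set H)
  semibounded : b.semiBounds.Nonempty
  continuous : ∃ M : ℝ, ∀ u v : b.dom, ‖b.toFun u v‖ ≤ M * b.formNorm u * b.formNorm v
  closed : ∀ u : ℕ → b.dom,
    (∀ ε > 0, ∃ N, ∀ m ≥ N, ∀ n ≥ N, b.formNorm (u m - u n) < ε) →
      ∃ v : b.dom, Tendsto (fun n => b.formNorm (u n - v)) atTop (𝓝 0)

/-- The restriction of a form to the elements of its domain that lie in the subspace `S`. -/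
def restrict (b : SesqForm H) (S : Submodule ℂ H) : SesqForm H where
  dom := b.dom ⊓ S
  toFun := LinearMap.mk₂'ₛₗ (RingHom.id ℂ) (starRingEnd ℂ)
    (fun u v => b.toFun ⟨u, u.2.1⟩ ⟨v, v.2.1⟩)
    (fun u u' v => by
      rw [← LinearMap.add_apply, ← map_add]; rfl)
    (fun c u v => by
      rw [← LinearMap.smul_apply, ← map_smulₛₗ]; rfl)
    (fun u v v' => by
      rw [← map_add]; rfl)
    (fun c u v => by
      rw [← map_smulₛₗ]; rfl)

/-- The graph of the operator associated to `b`: all `(u, f)` with `u ∈ D(b)` and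
`b(u,v) = ⟨f,v⟩` for all `v ∈ D(b)`. -/
def opGraph (b : SesqForm H) : Submodule ℂ (H × H) where
  carrier := {p | ∃ hu : p.1 ∈ b.dom, ∀ v : b.dom, b.toFun ⟨p.1, hu⟩ v = ip p.2 (v : H)}
  add_mem' := by
    rintro ⟨u, f⟩ ⟨u', f'⟩ ⟨hu, h⟩ ⟨hu', h'⟩
    refine ⟨b.dom.add_mem hu hu', fun v => ?_⟩
    have : (⟨u + u', b.dom.add_mem hu hu'⟩ : b.dom) = ⟨u, hu⟩ + ⟨u', hu'⟩ := rfl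
    simp only [Prod.mk_add_mk, this, map_add, LinearMap.add_apply, inner_add_right]
    rw [h v, h' v]
  zero_mem' := by
    refine ⟨b.dom.zero_mem, fun v => ?_⟩
    change b.toFun 0 v = ip 0 (v : H)
    simp
  smul_mem' := by
    rintro c ⟨u, f⟩ ⟨hu, h⟩
    refine ⟨b.dom.smul_mem c hu, fun v => ?_⟩
    have : (⟨c • u, b.dom.smul_mem c hu⟩ : b.dom) = c • ⟨u, hu⟩ := rfl
    simp only [Prod.smul_mk, this, map_smul, LinearMap.smul_apply, inner_smul_right, smul_eq_mul]
    rw [h v]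

/-- The operator associated to a (densely defined) form. -/
def op (b : SesqForm H) : H →ₗ.[ℂ] H := b.opGraph.toLinearPMap

end SesqForm

end Forms

/-! ### Admissible forms and their abstract Neumann traces -/

section Admissible

variable {d : ℕ} {Ω : Set (Eucl d)}

/-- An admissible form on `L²(Ω)`: a generating, symmetric form such that, for some
`ρ ∈ (0,1)`, one has `C_c^∞(Ω) ⊆ D(b) ⊆ H^{1/2+ρ}(Ω)`, the latter embedding being continuous and
dense. -/
structure IsAdmissible (b : SesqForm (L2Dom Ω)) : Prop where
  generating : b.IsGenerating
  symm : b.IsSymm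
  test_mem : ∀ φ : Eucl d → ℂ, ContDiff ℝ (⊤ : ℕ∞) φ → HasCompactSupport φ → tsupport φ ⊆ Ω →
    ∀ u : L2Dom Ω, u =ᵐ[volume.restrict Ω] φ → u ∈ b.dom
  embedding : ∃ ρ : ℝ, 0 < ρ ∧ ρ < 1 ∧
    (∃ C : ℝ≥0, ∀ u : b.dom,
      sobolevENormOn Ω (1 / 2 + ρ) (u : L2Dom Ω) ≤ C * ENNReal.ofReal (b.formNorm u)) ∧
    (∀ w : L2Dom Ω, sobolevENormOn Ω (1 / 2 + ρ) w < ⊤ → ∀ ε : ℝ≥0∞, 0 < ε →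
      ∃ u : b.dom, sobolevENormOn Ω (1 / 2 + ρ) (fun x => w x - (u : L2Dom Ω) x) < ε)

/-- The Neumann realization `B_N`, the operator associated to `b`. -/
def neumannOp (b : SesqForm (L2Dom Ω)) : L2Dom Ω →ₗ.[ℂ] L2Dom Ω := b.op

/-- The Dirichlet realization `B_D`, the operator associated to the restriction of `b` to
`{u ∈ D(b) | tr u = 0}`. -/
def dirichletOp (b : SesqForm (L2Dom Ω)) : L2Dom Ω →ₗ.[ℂ] L2Dom Ω :=
  (b.restrict (traceKer Ω)).op

/-- `B_0`, the restriction of `B_N` to `D(B_D) ∩ D(B_N)`. -/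
def minimalOp (b : SesqForm (L2Dom Ω)) : L2Dom Ω →ₗ.[ℂ] L2Dom Ω :=
  (neumannOp b).domRestrict (dirichletOp b).domain

/-- The adjoint `B_0^*`. -/
def maximalOp (b : SesqForm (L2Dom Ω)) : L2Dom Ω →ₗ.[ℂ] L2Dom Ω := (minimalOp b).adjoint

/-- The relation `g = N^b u`: `u ∈ D(b) ∩ D(B_0^*)` and
`⟨B_0^* u, v⟩_Ω - b(u,v) = ⟨g, tr v⟩_Γ` for all `v ∈ D(b)`. -/
def IsFormNeumannTrace (b : SesqForm (L2Dom Ω)) (u : L2Dom Ω) (g : L2Bdry Ω) : Prop :=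
  ∃ (hu : u ∈ b.dom) (hu' : u ∈ (maximalOp b).domain), ∀ (v : b.dom) (h : L2Bdry Ω),
    HasTrace Ω v h → ip (maximalOp b ⟨u, hu'⟩) (v : L2Dom Ω) - b.toFun ⟨u, hu⟩ v = ip g h

/-- The relation `g = 𝒩^b u`: `u ∈ D(B_0^*)` and
`⟨B_0^* u, v⟩_Ω - ⟨u, B_N v⟩_Ω = ⟨g, tr v⟩_Γ` for all `v ∈ D(B_N)`. -/
def IsOpNeumannTrace (b : SesqForm (L2Dom Ω)) (u : L2Dom Ω) (g : L2Bdry Ω) : Prop :=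
  ∃ hu : u ∈ (maximalOp b).domain, ∀ (v : (neumannOp b).domain) (h : L2Bdry Ω),
    HasTrace Ω v h → ip (maximalOp b ⟨u, hu⟩) (v : L2Dom Ω) - ip u (neumannOp b v) = ip g h

/-- The graph of `N^b`. -/
def formNeumannGraph (b : SesqForm (L2Dom Ω)) : Submodule ℂ (L2Dom Ω × L2Bdry Ω) where
  carrier := {p | IsFormNeumannTrace b p.1 p.2}
  add_mem' := by
    rintro ⟨u, g⟩ ⟨u', g'⟩ ⟨hu, hm, h⟩ ⟨hu', hm', h'⟩
    refine ⟨b.dom.add_mem hu hu', (maximalOp b).domain.add_mem hm hm', fun v k hk => ?_⟩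
    have e1 : (⟨u + u', b.dom.add_mem hu hu'⟩ : b.dom) = ⟨u, hu⟩ + ⟨u', hu'⟩ := rfl
    have e2 : (⟨u + u', (maximalOp b).domain.add_mem hm hm'⟩ : (maximalOp b).domain)
      = ⟨u, hm⟩ + ⟨u', hm'⟩ := rfl
    have h1 := h v k hk
    dsimp only [ip] at h1
    have h2 := h' v k hk
    dsimp only [ip] at h2
    simp only [Prod.mk_add_mk, e1, e2, LinearPMap.map_add, map_add, LinearMap.add_apply,
      inner_add_right]
    rw [← h1, ← h2]
    ring
  zero_mem' := by
    refine ⟨b.dom.zero_mem, (maximalOp b).domain.zero_mem, fun v k hk => ?_⟩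
    change ip (maximalOp b 0) (v : L2Dom Ω) - b.toFun 0 v = ip 0 k
    simp
  smul_mem' := by
    rintro c ⟨u, g⟩ ⟨hu, hm, h⟩
    refine ⟨b.dom.smul_mem c hu, (maximalOp b).domain.smul_mem c hm, fun v k hk => ?_⟩
    have e1 : (⟨c • u, b.dom.smul_mem c hu⟩ : b.dom) = c • ⟨u, hu⟩ := rfl
    have e2 : (⟨c • u, (maximalOp b).domain.smul_mem c hm⟩ : (maximalOp b).domain)
      = c • ⟨u, hm⟩ := rfl
    have h1 := h v k hk
    dsimp only [ip] at h1
    simp only [Prod.smul_mk, e1, e2, LinearPMap.map_smul, map_smul, LinearMap.smul_apply,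
      inner_smul_right, smul_eq_mul]
    rw [← h1]
    ring

/-- The graph of `𝒩^b`. -/
def opNeumannGraph (b : SesqForm (L2Dom Ω)) : Submodule ℂ (L2Dom Ω × L2Bdry Ω) where
  carrier := {p | IsOpNeumannTrace b p.1 p.2}
  add_mem' := by
    rintro ⟨u, g⟩ ⟨u', g'⟩ ⟨hm, h⟩ ⟨hm', h'⟩
    refine ⟨(maximalOp b).domain.add_mem hm hm', fun v k hk => ?_⟩
    have e2 : (⟨u + u', (maximalOp b).domain.add_mem hm hm'⟩ : (maximalOp b).domain)
      = ⟨u, hm⟩ + ⟨u', hm'⟩ := rfl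
    have h1 := h v k hk
    dsimp only [ip] at h1
    have h2 := h' v k hk
    dsimp only [ip] at h2
    simp only [Prod.mk_add_mk, e2, LinearPMap.map_add, inner_add_right]
    rw [← h1, ← h2]
    ring
  zero_mem' := by
    refine ⟨(maximalOp b).domain.zero_mem, fun v k hk => ?_⟩
    change ip (maximalOp b 0) (v : L2Dom Ω) - ip 0 (neumannOp b v) = ip 0 k
    simp
  smul_mem' := by
    rintro c ⟨u, g⟩ ⟨hm, h⟩
    refine ⟨(maximalOp b).domain.smul_mem c hm, fun v k hk => ?_⟩
    have e2 : (⟨c • u, (maximalOp b).domain.smul_mem c hm⟩ : (maximalOp b).domain)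
      = c • ⟨u, hm⟩ := rfl
    have h1 := h v k hk
    dsimp only [ip] at h1
    simp only [Prod.smul_mk, e2, LinearPMap.map_smul, inner_smul_right]
    rw [← h1]
    ring

/-- The abstract Neumann trace `N^b`, an operator from `L²(Ω)` to `L²(Γ)`. -/
def formNeumann (b : SesqForm (L2Dom Ω)) : L2Dom Ω →ₗ.[ℂ] L2Bdry Ω :=
  (formNeumannGraph b).toLinearPMap

/-- The abstract Neumann trace `𝒩^b`, an operator from `L²(Ω)` to `L²(Γ)`. -/
def opNeumann (b : SesqForm (L2Dom Ω)) : L2Dom Ω →ₗ.[ℂ] L2Bdry Ω :=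
  (opNeumannGraph b).toLinearPMap

/-- The kernel of an unbounded operator, as a subspace of the ambient space. -/
def pker {H G : Type*} [AddCommGroup H] [Module ℂ H] [AddCommGroup G] [Module ℂ G]
    (T : H →ₗ.[ℂ] G) : Submodule ℂ H :=
  (LinearMap.ker T.toFun).map T.domain.subtype

end Admissible

end AbstractNeumann

end

open AbstractNeumann

/-!
The proof splits into a trace theorem and an abstract operator-theoretic part.

*Trace theorem.* For `s > 1/2` and a function `φ` that is continuous up to the boundary, the norm
of `φ` in `L²(Γ)` is bounded by the norm in `H^s(ℝ^d)` of any extension `U` of `φ|_Ω`. Near a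
boundary point, `Γ` is a piece `T` of a Lipschitz graph with axis `e`, and one looks at the strips
of height `r` above `T`, which lie in `Ω`. Comparing the lower half of a strip with its translate in
direction `e`, and using that `‖U(· - a) - U‖` is at most a constant times `‖a‖ ^ s` times the norm
of `U` in `H^s` (`eLpNorm_comp_sub_sub_le`), one sees that the root mean square of `φ` over the
strip grows by at most a multiple of `r ^ (s - 1/2)` when the height is halved
(`eLpNorm_graphStrip_halve_le`). As `s > 1/2`, these increments are summable, and Fatou's lemma
bounds `φ` on `T`. Only values of `U` in `Ω` enter, so the bound is in terms of the norm of
`H^s(Ω)` (`IsBoundedLipschitzDomain.exists_eLpNorm_surfaceMeasure_le`). Together with the density of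
Schwartz functions in `H^s(ℝ^d)` this yields existence, uniqueness and boundedness of the trace. The
surface measure is finite, so boundary values of Schwartz functions are dense in `L²(Γ)`, and since
`D(b)` is dense in `H^{1/2 + ρ}(Ω)`, the trace maps `D(b)` to a dense subspace of `L²(Γ)`.

*Operators.* With the form norm, `D(b)` is a Hilbert space `V` with an injective embedding
`J : V → L²(Ω)` of dense range and a bounded trace `τ : V → L²(Γ)` of dense range (`FormModel`).
Writing `c = 1 - l` with `l` the maximal semi-bound, `B_N + c` is the inverse of `A = J J*`, and
`B_0` is the part of `B_N` on which `τ J* (B_N + c)` vanishes. Hence `B_0` is closed and symmetric,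
and `B_0** = B_0`. The range of `J*` is dense in `V`, so that `D(B_N)` is a core of the form: this
gives the density of `tr (D(B_N))`, and shows that the identity defining `𝒩^b u` on `D(B_N)` extends
to all of `D(b)` when `u ∈ D(b)`. Self-adjointness of `B_N` identifies the kernels. Finally, if
`N^b` is surjective, then each `u ∈ D(𝒩^b)` differs from some `w ∈ D(N^b)` with the same image by an
element of `ker 𝒩^b = D(B_N) ⊆ D(N^b)`.
-/

namespace AbstractNeumann

/-! ### Fractional Sobolev norms on the whole space -/

theorem sobolevENorm_toLp {d : ℕ} (s : ℝ) (ψ : 𝓢(Eucl d, ℂ)) :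
    sobolevENorm s (ψ.toLp 2) =
      eLpNorm (fun ξ : Eucl d => ((1 + ‖ξ‖ ^ 2) ^ (s / 2) : ℝ) • (𝓕 ψ) ξ) 2 volume := by
  unfold sobolevENorm
  rw [SchwartzMap.toLp_fourier_eq]
  refine eLpNorm_congr_ae ?_
  filter_upwards [(𝓕 ψ).coeFn_toLp 2 volume] with ξ hξ
  rw [hξ]

theorem sobolevENorm_toLp_lt_top {d : ℕ} (s : ℝ) (ψ : 𝓢(Eucl d, ℂ)) :
    sobolevENorm s (ψ.toLp 2) < ⊤ := by
  rw [sobolevENorm_toLp]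
  have h := ((SchwartzMap.smulLeftCLM ℂ (fun ξ : Eucl d => (1 + ‖ξ‖ ^ 2) ^ (s / 2)))
    (𝓕 ψ)).memLp 2 volume
  refine lt_of_le_of_lt (le_of_eq ?_) h.2
  congr 1
  ext ξ
  rw [SchwartzMap.smulLeftCLM_apply_apply (by fun_prop)]

theorem one_le_sobolevWeight {d : ℕ} {s : ℝ} (hs : 0 ≤ s) (ξ : Eucl d) :
    (1 : ℝ) ≤ (1 + ‖ξ‖ ^ 2) ^ (s / 2) :=
  Real.one_le_rpow (by nlinarith [sq_nonneg ‖ξ‖]) (by linarith)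

/-- By Plancherel's theorem, the `L²` norm is dominated by every Sobolev norm. -/
theorem enorm_le_sobolevENorm {d : ℕ} {s : ℝ} (hs : 0 ≤ s)
    (U : Lp ℂ 2 (volume : Measure (Eucl d))) : ‖U‖ₑ ≤ sobolevENorm s U := by
  have h1 : ‖U‖ₑ = ‖𝓕 U‖ₑ := by
    rw [← ofReal_norm, ← ofReal_norm, Lp.norm_fourier_eq]
  rw [h1, Lp.enorm_def]
  refine eLpNorm_mono fun ξ => ?_
  rw [norm_smul, Real.norm_of_nonneg (by positivity)]
  exact le_mul_of_one_le_left (norm_nonneg _) (one_le_sobolevWeight hs ξ)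

theorem memLp_sobolevWeight_smul {d : ℕ} {s : ℝ} {U : Lp ℂ 2 (volume : Measure (Eucl d))}
    (hU : sobolevENorm s U < ⊤) :
    MemLp (fun ξ : Eucl d => ((1 + ‖ξ‖ ^ 2) ^ (s / 2) : ℝ) • (𝓕 U) ξ) 2 volume := by
  refine ⟨?_, hU⟩
  have hc : Continuous fun ξ : Eucl d => ((1 + ‖ξ‖ ^ 2) ^ (s / 2) : ℝ) :=
    Continuous.rpow_const (by fun_prop) fun ξ => Or.inl (by positivity)
  exact hc.aestronglyMeasurable.smul (Lp.aestronglyMeasurable (𝓕 U))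

/-- Schwartz functions are dense in `H^s(ℝ^d)`. -/
theorem exists_schwartz_sobolevENorm_sub_lt {d : ℕ} (s : ℝ)
    {U : Lp ℂ 2 (volume : Measure (Eucl d))} (hU : sobolevENorm s U < ⊤) {ε : ℝ≥0∞}
    (hε : 0 < ε) : ∃ ψ : 𝓢(Eucl d, ℂ), sobolevENorm s (ψ.toLp 2 volume - U) < ε := by
  obtain ⟨W, hW⟩ : ∃ W, W = (memLp_sobolevWeight_smul hU).toLp := ⟨_, rfl⟩
  obtain ⟨χ, hχ⟩ : ∃ χ : 𝓢(Eucl d, ℂ),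
      ‖χ.toLp 2 (volume : Measure (Eucl d)) - W‖ₑ < ε := by
    have hd := SchwartzMap.denseRange_toLpCLM (E := Eucl d) (F := ℂ) (p := 2)
      (μ := (volume : Measure (Eucl d))) ENNReal.ofNat_ne_top
    obtain ⟨y, hy, χ, rfl⟩ := Metric.dense_iff.1 hd W (min ε 1).toReal
      (ENNReal.toReal_pos (by simp [hε.ne']) (by simp))
    refine ⟨χ, lt_of_lt_of_le ?_ (min_le_left ε 1)⟩
    rw [Metric.mem_ball, dist_eq_norm] at hy
    rw [← ofReal_norm, ENNReal.ofReal_lt_iff_lt_toReal (norm_nonneg _) (by simp)]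
    exact hy
  -- Divide by the weight on the Fourier side.
  set χ' := SchwartzMap.smulLeftCLM ℂ (fun ξ : Eucl d => (1 + ‖ξ‖ ^ 2) ^ (-(s / 2))) χ with hχ'
  refine ⟨𝓕⁻ χ', lt_of_le_of_lt (le_of_eq ?_) hχ⟩
  rw [Lp.enorm_def]
  refine eLpNorm_congr_ae ?_
  have e1 : 𝓕 (SchwartzMap.toLp (𝓕⁻ χ') 2 (volume : Measure (Eucl d)) - U) =
      χ'.toLp 2 (volume : Measure (Eucl d)) - 𝓕 U := by
    have := map_sub (Lp.fourierTransformₗᵢ (Eucl d) ℂ)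
      (SchwartzMap.toLp (𝓕⁻ χ') 2 (volume : Measure (Eucl d))) U
    refine this.trans ?_
    congr 1
    change 𝓕 (SchwartzMap.toLp (𝓕⁻ χ') 2 (volume : Measure (Eucl d))) = _
    rw [SchwartzMap.toLp_fourier_eq, FourierTransform.fourier_fourierInv_eq]
  rw [e1]
  filter_upwards [Lp.coeFn_sub (χ'.toLp 2 (volume : Measure (Eucl d))) (𝓕 U),
    Lp.coeFn_sub (χ.toLp 2 (volume : Measure (Eucl d))) W, χ.coeFn_toLp 2 volume,
    χ'.coeFn_toLp 2 volume, hW ▸ (memLp_sobolevWeight_smul hU).coeFn_toLp] with ξ h1 h2 h3 h4 h5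
  rw [h1, h2, Pi.sub_apply, Pi.sub_apply, h3, h4, h5, hχ',
    SchwartzMap.smulLeftCLM_apply_apply (by fun_prop), smul_sub, smul_smul,
    ← Real.rpow_add (by positivity), add_neg_cancel, Real.rpow_zero, one_smul]

/-! ### Translations are Hölder continuous on Sobolev spaces -/

theorem SchwartzMap.fourier_compSubConst {d : ℕ} (ψ : 𝓢(Eucl d, ℂ)) (a ξ : Eucl d) :
    (𝓕 (ψ.compSubConstCLM ℂ a)) ξ = Real.fourierChar (-inner ℝ a ξ) • (𝓕 ψ) ξ := by
  have h := congrFun (VectorFourier.fourierIntegral_comp_add_right Real.fourierChar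
    (volume : Measure (Eucl d)) (innerₗ (Eucl d)) ψ (-a)) ξ
  simp only [innerₗ_apply_apply, inner_neg_left] at h
  rw [SchwartzMap.fourier_coe, SchwartzMap.fourier_coe]
  refine Eq.trans ?_ h
  rfl

/-- Interpolation between the bound `2` and the Lipschitz bound for the character. -/
theorem norm_fourierChar_sub_one_le {s : ℝ} (hs : 0 ≤ s) (hs1 : s ≤ 1) (t : ℝ) :
    ‖(Real.fourierChar t : ℂ) - 1‖ ≤ 2 * (2 * Real.pi * |t|) ^ s := by
  have hθ : 0 ≤ 2 * Real.pi * |t| := by positivity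
  rcases le_total 1 (2 * Real.pi * |t|) with h | h
  · calc ‖(Real.fourierChar t : ℂ) - 1‖ ≤ ‖(Real.fourierChar t : ℂ)‖ + ‖(1 : ℂ)‖ := norm_sub_le _ _
      _ = 2 := by rw [Circle.norm_coe, norm_one]; norm_num
      _ ≤ 2 * (2 * Real.pi * |t|) ^ s := by
        linarith [Real.one_le_rpow h hs]
  · have h1 : ‖(Real.fourierChar t : ℂ) - 1‖ ≤ 2 * Real.pi * |t| := by
      rw [Real.fourierChar_apply, mul_comm _ Complex.I]
      refine Real.norm_exp_I_mul_ofReal_sub_one_le.trans (le_of_eq ?_)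
      rw [Real.norm_eq_abs, abs_mul, abs_of_pos (by positivity : (0 : ℝ) < 2 * Real.pi)]
    have h2 : 2 * Real.pi * |t| ≤ (2 * Real.pi * |t|) ^ s := by
      rcases hθ.eq_or_lt with h0 | h0
      · rw [← h0]; positivity
      · exact Real.self_le_rpow_of_le_one hθ h hs1
    linarith

theorem eLpNorm_comp_sub_sub_le_of_schwartz {d : ℕ} {s : ℝ} (hs : 0 ≤ s) (hs1 : s ≤ 1)
    (ψ : 𝓢(Eucl d, ℂ)) (a : Eucl d) :
    eLpNorm (fun x => ψ (x - a) - ψ x) 2 volume ≤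
      ENNReal.ofReal (2 * (2 * Real.pi * ‖a‖) ^ s) * sobolevENorm s (ψ.toLp 2) := by
  have e1 : eLpNorm (fun x => ψ (x - a) - ψ x) 2 volume =
      ‖(ψ.compSubConstCLM ℂ a - ψ).toLp 2 (volume : Measure (Eucl d))‖ₑ := by
    rw [Lp.enorm_def]
    refine eLpNorm_congr_ae ?_
    filter_upwards [(ψ.compSubConstCLM ℂ a - ψ).coeFn_toLp 2 volume] with x hx
    rw [hx]; rfl
  have e2 : ‖(ψ.compSubConstCLM ℂ a - ψ).toLp 2 (volume : Measure (Eucl d))‖ₑ =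
      eLpNorm (𝓕 (ψ.compSubConstCLM ℂ a - ψ) : 𝓢(Eucl d, ℂ)) 2 volume := by
    rw [← ofReal_norm, ← Lp.norm_fourier_eq, SchwartzMap.toLp_fourier_eq, ofReal_norm,
      Lp.enorm_def]
    exact eLpNorm_congr_ae (SchwartzMap.coeFn_toLp _ 2 volume)
  rw [e1, e2, sobolevENorm_toLp]
  have hpos : (0 : ℝ) ≤ 2 * (2 * Real.pi * ‖a‖) ^ s := by positivity
  rw [← Real.enorm_of_nonneg hpos, ← eLpNorm_const_smul]
  refine eLpNorm_mono fun ξ => ?_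
  have e3 : (𝓕 (ψ.compSubConstCLM ℂ a - ψ)) ξ =
      ((Real.fourierChar (-inner ℝ a ξ) : ℂ) - 1) * (𝓕 ψ) ξ := by
    have : 𝓕 (ψ.compSubConstCLM ℂ a - ψ) = 𝓕 (ψ.compSubConstCLM ℂ a) - 𝓕 ψ :=
      map_sub (FourierTransform.fourierCLM ℂ 𝓢(Eucl d, ℂ)) _ _
    rw [this, sub_apply, SchwartzMap.fourier_compSubConst, Circle.smul_def, smul_eq_mul]
    ring
  rw [e3, norm_mul, Pi.smul_apply, norm_smul, norm_smul, Real.norm_of_nonneg hpos,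
    Real.norm_of_nonneg (by positivity : (0 : ℝ) ≤ (1 + ‖ξ‖ ^ 2) ^ (s / 2)), ← mul_assoc]
  gcongr
  refine (norm_fourierChar_sub_one_le hs hs1 _).trans ?_
  -- The phase is at most `2π ‖a‖` times the square root of the Sobolev weight `1 + ‖ξ‖ ^ 2`.
  have h1 : |-inner ℝ a ξ| ≤ ‖a‖ * (1 + ‖ξ‖ ^ 2) ^ (1 / 2 : ℝ) := by
    rw [abs_neg]
    refine (abs_real_inner_le_norm a ξ).trans ?_
    gcongr
    rw [← Real.sqrt_eq_rpow]
    exact Real.le_sqrt_of_sq_le (by linarith)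
  calc 2 * (2 * Real.pi * |-inner ℝ a ξ|) ^ s
      ≤ 2 * (2 * Real.pi * (‖a‖ * (1 + ‖ξ‖ ^ 2) ^ (1 / 2 : ℝ))) ^ s := by gcongr
    _ = 2 * (2 * Real.pi * ‖a‖) ^ s * (1 + ‖ξ‖ ^ 2) ^ (s / 2) := by
      rw [← mul_assoc _ ‖a‖, Real.mul_rpow (by positivity) (by positivity),
        ← Real.rpow_mul (by positivity), one_div_mul_eq_div, mul_assoc 2 (_ ^ s)]

/-- Translations are Hölder continuous of order `s ∈ [0, 1]` on `H^s(ℝ^d)`, in the `L²` norm. -/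
theorem eLpNorm_comp_sub_sub_le {d : ℕ} {s : ℝ} (hs : 0 ≤ s) (hs1 : s ≤ 1)
    (U : Lp ℂ 2 (volume : Measure (Eucl d))) (a : Eucl d) :
    eLpNorm (fun x => U (x - a) - U x) 2 volume ≤
      ENNReal.ofReal (2 * (2 * Real.pi * ‖a‖) ^ s) * sobolevENorm s U := by
  rcases eq_or_ne a 0 with rfl | ha
  · simp
  set c := ENNReal.ofReal (2 * (2 * Real.pi * ‖a‖) ^ s) with hc
  have hc0 : c ≠ 0 := by
    have := norm_pos_iff.2 ha
    exact (ENNReal.ofReal_pos.2 (by positivity)).ne'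
  rcases (le_top (a := sobolevENorm s U)).eq_or_lt with hU | hU
  · rw [hU, ENNReal.mul_top hc0]; exact le_top
  have hmp : MeasurePreserving (fun x : Eucl d => x - a) volume volume :=
    measurePreserving_sub_right volume a
  have key : ∀ η : ℝ≥0∞, 0 < η → eLpNorm (fun x => U (x - a) - U x) 2 volume ≤
      c * (sobolevENorm s U + η) + (η + η) := by
    intro η hη
    obtain ⟨ψ, hψ⟩ := exists_schwartz_sobolevENorm_sub_lt s hU hη
    obtain ⟨W, hW⟩ : ∃ W, W = ψ.toLp 2 volume - U := ⟨_, rfl⟩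
    rw [← hW] at hψ
    have hWη : eLpNorm W 2 volume ≤ η := by
      rw [← Lp.enorm_def]
      exact (enorm_le_sobolevENorm hs W).trans hψ.le
    have hWa : eLpNorm (fun x => W (x - a)) 2 volume ≤ η := by
      refine le_trans (le_of_eq ?_) hWη
      exact eLpNorm_comp_measurePreserving (Lp.aestronglyMeasurable W) hmp
    have hWm : AEStronglyMeasurable (fun x => W (x - a)) volume :=
      (Lp.aestronglyMeasurable W).comp_measurePreserving hmp
    have hrep : (W : Eucl d → ℂ) =ᵐ[volume] fun x => ψ x - U x := by
      rw [hW]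
      filter_upwards [Lp.coeFn_sub (ψ.toLp 2 volume) U, ψ.coeFn_toLp 2 volume] with x h1 h2
      rw [h1, Pi.sub_apply, h2]
    have hψN : sobolevENorm s (ψ.toLp 2) ≤ sobolevENorm s U + η := by
      have : ψ.toLp 2 volume = U + W := by rw [hW]; abel
      rw [this]
      exact (sobolevENorm_add_le s U W).trans (by gcongr)
    calc eLpNorm (fun x => U (x - a) - U x) 2 volume
        = eLpNorm ((fun x => ψ (x - a) - ψ x) - ((fun x => W (x - a)) - fun x => W x)) 2 volume := by
          refine eLpNorm_congr_ae ?_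
          filter_upwards [hrep, hmp.quasiMeasurePreserving.ae hrep] with x h1 h2
          simp only [Pi.sub_apply, h1, h2]
          ring
      _ ≤ eLpNorm (fun x => ψ (x - a) - ψ x) 2 volume
          + eLpNorm ((fun x => W (x - a)) - fun x => W x) 2 volume :=
          eLpNorm_sub_le (by
            have := ψ.continuous
            exact Continuous.aestronglyMeasurable (by fun_prop))
            (hWm.sub (Lp.aestronglyMeasurable W)) (by norm_num)
      _ ≤ c * (sobolevENorm s U + η) + (η + η) := by
          refine add_le_add ?_ ?_
          · exact (eLpNorm_comp_sub_sub_le_of_schwartz hs hs1 ψ a).trans (by gcongr)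
          · exact (eLpNorm_sub_le hWm (Lp.aestronglyMeasurable W) (by norm_num)).trans
              (add_le_add hWa hWη)
  have hlim : Tendsto (fun η : ℝ≥0∞ => c * (sobolevENorm s U + η) + (η + η)) (𝓝[>] 0)
      (𝓝 (c * (sobolevENorm s U + 0) + (0 + 0))) := by
    have hid : Tendsto (fun η : ℝ≥0∞ => η) (𝓝[>] 0) (𝓝 0) := nhdsWithin_le_nhds
    exact (ENNReal.Tendsto.const_mul (tendsto_const_nhds.add hid)
      (Or.inr ENNReal.ofReal_ne_top)).add (hid.add hid)
  rw [add_zero, add_zero, add_zero] at hlim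
  exact ge_of_tendsto hlim (eventually_nhdsWithin_of_forall key)

/-! ### Surface measure on a Lipschitz graph -/

/-- The signed distance, in the direction of the axis `e`, from `x` to the graph of `h`. -/
noncomputable def graphHeight {d : ℕ} (e : Eucl d) (h : Eucl d → ℝ) (x : Eucl d) : ℝ :=
  inner ℝ e x - h (x - (inner ℝ e x : ℝ) • e)

/-- The points whose height above the graph of `h` lies strictly between `a` and `b` and whose
vertical projection to the graph lies in `T`. -/
def graphStrip {d : ℕ} (e : Eucl d) (h : Eucl d → ℝ) (T : Set (Eucl d)) (a b : ℝ) :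
    Set (Eucl d) :=
  {x | x - graphHeight e h x • e ∈ T ∧ graphHeight e h x ∈ Ioo a b}

section Graph

variable {d : ℕ} {e : Eucl d} {h : Eucl d → ℝ} {T : Set (Eucl d)}

theorem graphHeight_add_smul (he : ‖e‖ = 1) (x : Eucl d) (t : ℝ) :
    graphHeight e h (x + t • e) = graphHeight e h x + t := by
  have h1 : inner ℝ e (x + t • e) = inner ℝ e x + t := by
    rw [inner_add_right, real_inner_smul_right, real_inner_self_eq_norm_sq, he]; ring
  have h2 : x + t • e - (inner ℝ e x + t) • e = x - (inner ℝ e x : ℝ) • e := by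
    rw [add_smul]; abel
  unfold graphHeight
  rw [h1, h2]; ring

theorem continuous_graphHeight (hh : Continuous h) : Continuous (graphHeight e h) := by
  unfold graphHeight
  fun_prop

theorem measurableSet_graphStrip (hh : Continuous h) (hT : MeasurableSet T) (a b : ℝ) :
    MeasurableSet (graphStrip e h T a b) := by
  have hc := continuous_graphHeight (e := e) hh
  have h1 : Continuous fun x => x - graphHeight e h x • e := by fun_prop
  exact (h1.measurable hT).inter (hc.measurable measurableSet_Ioo)

theorem add_smul_mem_graphStrip_iff (he : ‖e‖ = 1) {x : Eucl d} {a b t : ℝ} :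
    x + t • e ∈ graphStrip e h T a b ↔ x ∈ graphStrip e h T (a - t) (b - t) := by
  have h2 : x + t • e - (graphHeight e h x + t) • e = x - graphHeight e h x • e := by
    rw [add_smul]; abel
  simp only [graphStrip, mem_ofPred_eq, graphHeight_add_smul he, h2, mem_Ioo, sub_lt_iff_lt_add,
    lt_sub_iff_add_lt]

/-- Orthogonal coordinates along the axis `e` and along the hyperplane orthogonal to it preserve
the volume. -/
theorem measurePreserving_add_smul_axis (he : ‖e‖ = 1) :
    MeasurePreserving (fun p : (ℝ ∙ e)ᗮ × ℝ => (p.1 : Eucl d) + p.2 • e)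
      (volume.prod volume) volume := by
  have h1 : MeasurePreserving (LinearIsometryEquiv.toSpanUnitSingleton e he) volume volume :=
    LinearIsometryEquiv.measurePreserving _
  have h2 := ((ℝ ∙ e).measurePreserving_measurableEquivProd (0 : Eucl d)).symm
  rw [InnerProductSpace.euclideanHausdorffMeasure_eq_volume] at h2
  have h3 : MeasurePreserving (Prod.map (LinearIsometryEquiv.toSpanUnitSingleton e he)
      (id : (ℝ ∙ e)ᗮ → (ℝ ∙ e)ᗮ)) (volume.prod volume) volume :=
    h1.prod (MeasurePreserving.id volume)
  have h4 := (h2.comp h3).comp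
    (Measure.measurePreserving_swap (μ := (volume : Measure (ℝ ∙ e)ᗮ)) (ν := (volume : Measure ℝ)))
  have h5 : (fun p : (ℝ ∙ e)ᗮ × ℝ => (p.1 : Eucl d) + p.2 • e) =
      (((ℝ ∙ e).measurableEquivProd (0 : Eucl d)).symm ∘
        Prod.map (LinearIsometryEquiv.toSpanUnitSingleton e he) id) ∘ Prod.swap := by
    funext p
    simp [add_comm]
  rw [h5]
  exact h4

theorem finrank_orthogonal_axis (he : ‖e‖ = 1) : Module.finrank ℝ (ℝ ∙ e)ᗮ = d - 1 := by
  have he0 : e ≠ 0 := by rintro rfl; simp at he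
  have h1 := (ℝ ∙ e).finrank_add_finrank_orthogonal
  rw [finrank_span_singleton he0, finrank_euclideanSpace, Fintype.card_fin] at h1
  omega

/-- On a Lipschitz graph the surface measure is dominated by the Lebesgue measure of the
projection to the base hyperplane. -/
theorem euclideanHausdorffMeasure_restrict_le_map_graph (he : ‖e‖ = 1) {K : ℝ≥0}
    (hh : LipschitzWith K h) (hT0 : ∀ x ∈ T, graphHeight e h x = 0) :
    ((Measure.euclideanHausdorffMeasure (d - 1) : Measure (Eucl d))).restrict T ≤
      ((1 + K) ^ (d - 1) : ℝ≥0) • (Measure.map (fun y : (ℝ ∙ e)ᗮ => (y : Eucl d) + h y • e)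
        volume) := by
  set g : (ℝ ∙ e)ᗮ → Eucl d := fun y => (y : Eucl d) + h y • e with hg
  have hgL : LipschitzWith (1 + K) g := by
    have a1 : LipschitzWith 1 (fun y : (ℝ ∙ e)ᗮ => (y : Eucl d)) := LipschitzWith.subtype_val _
    have a2 : LipschitzWith 1 fun t : ℝ => t • e := by
      refine LipschitzWith.of_dist_le_mul fun s t => ?_
      rw [dist_eq_norm, ← sub_smul, norm_smul, he, dist_eq_norm]; simp
    have a3 := a1.add (a2.comp (hh.comp a1))
    simpa using a3
  refine Measure.le_iff.2 fun A hA => ?_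
  rw [Measure.restrict_apply hA, Measure.smul_apply,
    Measure.map_apply hgL.continuous.measurable hA]
  -- On the graph, `g` inverts the orthogonal projection to the hyperplane.
  have hsub : A ∩ T ⊆ g '' (g ⁻¹' A) := by
    rintro x ⟨hxA, hxT⟩
    have hy : x - (inner ℝ e x : ℝ) • e ∈ (ℝ ∙ e)ᗮ := by
      rw [Submodule.mem_orthogonal_singleton_iff_inner_right, inner_sub_right,
        real_inner_smul_right, real_inner_self_eq_norm_sq, he]
      ring
    have hgx : g ⟨_, hy⟩ = x := by
      have h0 := hT0 x hxT
      rw [graphHeight, sub_eq_zero] at h0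
      simp only [hg, ← h0]
      abel
    exact ⟨⟨_, hy⟩, by rw [mem_preimage, hgx]; exact hxA, hgx⟩
  refine (measure_mono hsub).trans ?_
  have hvol : (volume : Measure (ℝ ∙ e)ᗮ) = Measure.euclideanHausdorffMeasure (d - 1) := by
    rw [← finrank_orthogonal_axis he, InnerProductSpace.euclideanHausdorffMeasure_eq_volume]
  rw [hvol, Measure.euclideanHausdorffMeasure_def, Measure.euclideanHausdorffMeasure_def,
    Measure.smul_apply, Measure.smul_apply, smul_comm]
  have := hgL.hausdorffMeasure_image_le (d := ((d - 1 : ℕ) : ℝ)) (by positivity) (g ⁻¹' A)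
  rw [ENNReal.rpow_natCast] at this
  gcongr
  simpa [ENNReal.smul_def] using this

/-- Fubini's theorem for the region above a piece `T` of the graph, as an inequality since the
surface measure is only compared with the measure of the base hyperplane. -/
theorem setLIntegral_graph_le (he : ‖e‖ = 1) {K : ℝ≥0} (hh : LipschitzWith K h)
    (hT : MeasurableSet T) (hT0 : ∀ x ∈ T, graphHeight e h x = 0) (r : ℝ) {F : Eucl d → ℝ≥0∞}
    (hF : Measurable F) :
    ∫⁻ x in T, (∫⁻ t in Ioo 0 r, F (x + t • e)) ∂(Measure.euclideanHausdorffMeasure (d - 1)) ≤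
      ((1 + K) ^ (d - 1) : ℝ≥0) * ∫⁻ x in graphStrip e h T 0 r, F x := by
  set g : (ℝ ∙ e)ᗮ → Eucl d := fun y => (y : Eucl d) + h y • e with hg
  have hhc := hh.continuous
  have hgm : Measurable g := by
    have : Continuous g := by fun_prop
    exact this.measurable
  have hI : Measurable fun x => ∫⁻ t in Ioo 0 r, F (x + t • e) := by
    refine Measurable.lintegral_prod_right' (f := fun p : Eucl d × ℝ => F (p.1 + p.2 • e)) ?_
    exact hF.comp (by fun_prop)
  have hstrip := measurableSet_graphStrip (e := e) hhc hT 0 r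
  have hle : (Measure.euclideanHausdorffMeasure (d - 1)).restrict T ≤
      (((1 + K) ^ (d - 1) : ℝ≥0) • Measure.map g volume).restrict T := by
    have := Measure.restrict_mono_measure
      (euclideanHausdorffMeasure_restrict_le_map_graph he hh hT0) T
    rwa [Measure.restrict_restrict hT, inter_self] at this
  refine (lintegral_mono' hle le_rfl).trans ?_
  rw [Measure.restrict_smul, lintegral_smul_measure, ENNReal.smul_def, smul_eq_mul]
  refine mul_le_mul' le_rfl ?_
  rw [setLIntegral_map hT hI hgm, ← lintegral_indicator hstrip,
    ← (measurePreserving_add_smul_axis he).lintegral_comp (hF.indicator hstrip),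
    lintegral_prod (fun p : (ℝ ∙ e)ᗮ × ℝ => (graphStrip e h T 0 r).indicator F
      ((p.1 : Eucl d) + p.2 • e)) ((hF.indicator hstrip).comp
      (measurePreserving_add_smul_axis he).measurable).aemeasurable,
    ← lintegral_indicator (hgm hT)]
  refine lintegral_mono fun y => ?_
  have hy : graphHeight e h (y : Eucl d) = - h y := by
    have : inner ℝ e (y : Eucl d) = 0 :=
      Submodule.mem_orthogonal_singleton_iff_inner_right.1 y.2
    simp [graphHeight, this]
  by_cases hyT : y ∈ g ⁻¹' T
  · rw [indicator_of_mem hyT, ← lintegral_indicator measurableSet_Ioo,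
      ← lintegral_sub_right_eq_self _ (h y)]
    refine lintegral_mono fun t => ?_
    by_cases ht : t - h y ∈ Ioo 0 r
    · have hmem : (y : Eucl d) + t • e ∈ graphStrip e h T 0 r := by
        rw [add_smul_mem_graphStrip_iff he]
        refine ⟨?_, ?_⟩
        · rw [hy, neg_smul, sub_neg_eq_add]; exact hyT
        · rw [hy]; exact ⟨by linarith [ht.1], by linarith [ht.2]⟩
      dsimp only
      rw [indicator_of_mem ht, indicator_of_mem hmem, hg]
      refine le_of_eq (congrArg F ?_)
      dsimp only
      rw [sub_smul]; abel
    · rw [indicator_of_notMem ht]; exact zero_le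
  · rw [indicator_of_notMem hyT]; exact zero_le

end Graph

/-! ### The trace inequality -/

/-- A triangle inequality in the Euclidean plane, for the vectors `(A, B)` and `(A, A)`. -/
theorem ENNReal.sqrt_two_mul_le_add {A B D E : ℝ≥0∞} (h1 : A ≤ B + D) (h2 : A ^ 2 + B ^ 2 ≤ E ^ 2) :
    ENNReal.ofReal √2 * A ≤ E + D := by
  rcases eq_or_ne E ⊤ with rfl | hE
  · simp
  rcases eq_or_ne D ⊤ with rfl | hD
  · simp
  have hAE : A ≤ E := (ENNReal.pow_le_pow_left_iff two_ne_zero).1 (le_self_add.trans h2)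
  have hBE : B ≤ E := (ENNReal.pow_le_pow_left_iff two_ne_zero).1 (le_add_self.trans h2)
  lift E to ℝ≥0 using hE
  lift D to ℝ≥0 using hD
  lift A to ℝ≥0 using (hAE.trans_lt ENNReal.coe_lt_top).ne
  lift B to ℝ≥0 using (hBE.trans_lt ENNReal.coe_lt_top).ne
  rw [ENNReal.ofReal]
  norm_cast at *
  rw [← NNReal.coe_le_coe] at *
  push_cast at *
  rw [Real.coe_toNNReal _ (Real.sqrt_nonneg 2)]
  have s2 : √2 ^ 2 = 2 := Real.sq_sqrt (by norm_num)
  have s1 : 1 ≤ √2 := Real.one_le_sqrt.2 (by norm_num)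
  have s3 : √2 ≤ 2 := by nlinarith
  have hA := A.2
  have hB := B.2
  have hD := D.2
  have hE := E.2
  rcases le_total (A : ℝ) D with hAD | hAD
  · nlinarith
  · have h4 : ((A : ℝ) - D) ^ 2 ≤ (B : ℝ) ^ 2 := by
      apply pow_le_pow_left₀ <;> linarith
    have h5 : (√2 * A - D) ^ 2 ≤ (E : ℝ) ^ 2 := by
      have h6 : (√2 * A - D) ^ 2 = 2 * (A : ℝ) ^ 2 - 2 * √2 * A * D + (D : ℝ) ^ 2 := by
        rw [sub_sq, mul_pow, s2]; ring
      nlinarith [mul_nonneg (mul_nonneg hA hD) (sub_nonneg.2 s1)]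
    linarith [abs_le_of_sq_le_sq h5 hE, le_abs_self (√2 * (A : ℝ) - D)]

theorem eLpNorm_two_sq {α : Type*} [MeasurableSpace α] (f : α → ℂ) (μ : Measure α) :
    eLpNorm f 2 μ ^ 2 = ∫⁻ x, ‖f x‖ₑ ^ 2 ∂μ := by
  have h := eLpNorm_nnreal_pow_eq_lintegral (f := f) (μ := μ) (p := 2) two_ne_zero
  have h2 : ((2 : ℝ≥0) : ℝ) = ((2 : ℕ) : ℝ) := by norm_num
  simp only [h2, ENNReal.rpow_natCast] at h
  exact_mod_cast h

section Strip

variable {d : ℕ} {Ω : Set (Eucl d)} {e : Eucl d} {h : Eucl d → ℝ} {T : Set (Eucl d)} {δ s : ℝ}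
  {φ : Eucl d → ℂ} {U : Lp ℂ 2 (volume : Measure (Eucl d))}

theorem graphStrip_mono {a b a' b' : ℝ} (ha : a' ≤ a) (hb : b ≤ b') :
    graphStrip e h T a b ⊆ graphStrip e h T a' b' :=
  fun _ hx => ⟨hx.1, Ioo_subset_Ioo ha hb hx.2⟩

theorem graphStrip_subset (hTΩ : ∀ x ∈ T, ∀ t ∈ Ioo 0 δ, x + t • e ∈ Ω) :
    graphStrip e h T 0 δ ⊆ Ω := fun x hx => by
  simpa using hTΩ _ hx.1 _ hx.2

/-- Halving the height of a strip increases the root mean square of a function on the strip by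
at most a multiple of `r ^ (s - 1/2)` times the `H^s` norm: the lower half of the strip is compared
with its translate, the upper half. -/
theorem eLpNorm_graphStrip_halve_le (he : ‖e‖ = 1) (hh : Continuous h) (hT : MeasurableSet T)
    (hTΩ : ∀ x ∈ T, ∀ t ∈ Ioo 0 δ, x + t • e ∈ Ω) (hΩ : MeasurableSet Ω)
    (hs : 0 ≤ s) (hs1 : s ≤ 1) (hφ : Continuous φ) (hU : U =ᵐ[volume.restrict Ω] φ)
    {r : ℝ} (hr : 0 < r) (hrδ : 2 * r ≤ δ) :
    ENNReal.ofReal √2 * eLpNorm φ 2 (volume.restrict (graphStrip e h T 0 r)) ≤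
      eLpNorm φ 2 (volume.restrict (graphStrip e h T 0 (2 * r))) +
        ENNReal.ofReal (2 * (2 * Real.pi * r) ^ s) * sobolevENorm s U := by
  have hmeas := fun a b => measurableSet_graphStrip (e := e) hh hT a b
  set R := graphStrip e h T 0 r with hR
  have hφa : Continuous fun x => φ (x + r • e) := by fun_prop
  have hmp : MeasurePreserving (fun x : Eucl d => x + r • e) volume volume :=
    measurePreserving_add_right volume _
  have hpre : (fun x : Eucl d => x + r • e) ⁻¹' graphStrip e h T r (2 * r) = R := by
    ext x
    rw [mem_preimage, add_smul_mem_graphStrip_iff he, sub_self, two_mul, add_sub_cancel_right]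
  refine ENNReal.sqrt_two_mul_le_add
    (B := eLpNorm (fun x => φ (x + r • e)) 2 (volume.restrict R)) ?_ ?_
  · have h1 : eLpNorm φ 2 (volume.restrict R) ≤
        eLpNorm (fun x => φ (x + r • e)) 2 (volume.restrict R) +
          eLpNorm (fun x => φ (x + r • e) - φ x) 2 (volume.restrict R) := by
      refine le_trans (le_of_eq ?_) (eLpNorm_sub_le (f := fun x => φ (x + r • e))
        (g := fun x => φ (x + r • e) - φ x) hφa.aestronglyMeasurable
        (hφa.sub hφ).aestronglyMeasurable (by norm_num))
      congr 1
      ext x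
      simp
    refine h1.trans ?_
    gcongr
    have h2 := eLpNorm_comp_sub_sub_le hs hs1 U (-(r • e))
    rw [norm_neg, norm_smul, he, mul_one, Real.norm_of_nonneg hr.le] at h2
    refine le_trans ?_ h2
    refine le_trans (le_of_eq (eLpNorm_congr_ae ?_))
      (eLpNorm_mono_measure _ (Measure.restrict_le_self (s := R)))
    have hU' := (ae_restrict_iff' hΩ).1 hU
    rw [EventuallyEq, ae_restrict_iff' (hmeas 0 r)]
    filter_upwards [hU', hmp.quasiMeasurePreserving.ae hU'] with x hx1 hx2 hxR
    rw [sub_neg_eq_add, hx1 (graphStrip_subset hTΩ (graphStrip_mono le_rfl (by linarith) hxR)),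
      hx2 (graphStrip_subset hTΩ (graphStrip_mono hr.le hrδ (hpre.ge hxR)))]
  · rw [eLpNorm_two_sq, eLpNorm_two_sq, eLpNorm_two_sq]
    have h3 : ∫⁻ x in R, ‖φ (x + r • e)‖ₑ ^ 2 =
        ∫⁻ x in graphStrip e h T r (2 * r), ‖φ x‖ₑ ^ 2 := by
      rw [← hmp.setLIntegral_comp_preimage (hmeas r (2 * r)) (by fun_prop), hpre]
    have hdisj : Disjoint R (graphStrip e h T r (2 * r)) :=
      disjoint_left.2 fun x hx hx' => lt_asymm hx.2.2 hx'.2.1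
    rw [h3, ← lintegral_union (hmeas r (2 * r)) hdisj]
    exact lintegral_mono_set (union_subset (graphStrip_mono le_rfl (by linarith))
      (graphStrip_mono hr.le le_rfl))

/-- The root mean square over the strips of height `δ / 2 ^ k` stays bounded. The subtracted term
makes the bound reproduce itself when the height is halved. -/
theorem eLpNorm_graphStrip_le (he : ‖e‖ = 1) (hh : Continuous h) (hT : MeasurableSet T)
    (hδ : 0 < δ) (hTΩ : ∀ x ∈ T, ∀ t ∈ Ioo 0 δ, x + t • e ∈ Ω) (hΩ : MeasurableSet Ω)
    (hs : 1 / 2 < s) (hs1 : s ≤ 1) (hφ : Continuous φ) (hU : U =ᵐ[volume.restrict Ω] φ) (k : ℕ) :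
    eLpNorm φ 2 (volume.restrict (graphStrip e h T 0 (δ / 2 ^ k))) ≤
      ENNReal.ofReal (√(δ / 2 ^ k) *
        (2 * (2 * Real.pi) ^ s / (2 ^ (s - 1 / 2) - 1) * δ ^ (s - 1 / 2) + 1 / √δ -
          2 * (2 * Real.pi) ^ s / (2 ^ (s - 1 / 2) - 1) * (δ / 2 ^ k) ^ (s - 1 / 2))) *
        sobolevENorm s U := by
  set c : ℝ := 2 * (2 * Real.pi) ^ s with hc
  have hc0 : 0 ≤ c := by positivity
  set q : ℝ := 2 ^ (s - 1 / 2) with hq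
  have hq1 : 0 < q - 1 := sub_pos.2 (Real.one_lt_rpow (by norm_num) (by linarith))
  set A : ℝ := c / (q - 1) * δ ^ (s - 1 / 2) + 1 / √δ with hA
  induction k with
  | zero =>
    have hδ' : √δ ≠ 0 := (Real.sqrt_pos.2 hδ).ne'
    have e1 : √(δ / 2 ^ 0) * (A - c / (q - 1) * (δ / 2 ^ 0) ^ (s - 1 / 2)) = 1 := by
      rw [hA, pow_zero, div_one, add_sub_cancel_left, mul_one_div_cancel hδ']
    rw [e1, ENNReal.ofReal_one, one_mul, pow_zero, div_one]
    refine le_trans ?_ (enorm_le_sobolevENorm (by linarith) U)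
    rw [Lp.enorm_def]
    calc eLpNorm φ 2 (volume.restrict (graphStrip e h T 0 δ))
        ≤ eLpNorm φ 2 (volume.restrict Ω) :=
          eLpNorm_mono_measure _ (Measure.restrict_mono (graphStrip_subset hTΩ) le_rfl)
      _ = eLpNorm U 2 (volume.restrict Ω) := eLpNorm_congr_ae hU.symm
      _ ≤ eLpNorm U 2 volume := eLpNorm_mono_measure _ Measure.restrict_le_self
  | succ k ih =>
    set r := δ / 2 ^ (k + 1) with hr
    have h2r : δ / 2 ^ k = 2 * r := by rw [hr, pow_succ]; field_simp
    have hr0 : 0 < r := by positivity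
    have h2rδ : 2 * r ≤ δ := by
      rw [← h2r]; exact div_le_self hδ.le (one_le_pow₀ (by norm_num))
    rw [h2r] at ih
    have hstep := eLpNorm_graphStrip_halve_le he hh hT hTΩ hΩ (by linarith) hs1 hφ hU hr0 h2rδ
    have hchain := hstep.trans (add_le_add_left ih _)
    have hσ : r ^ s = √r * r ^ (s - 1 / 2) := by
      rw [Real.sqrt_eq_rpow, ← Real.rpow_add hr0]; congr 1; ring
    have h2σ : (2 * r) ^ (s - 1 / 2) = q * r ^ (s - 1 / 2) := Real.mul_rpow (by norm_num) hr0.le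
    have hrδσ : q * r ^ (s - 1 / 2) ≤ δ ^ (s - 1 / 2) := by
      rw [← h2σ]; exact Real.rpow_le_rpow (by positivity) h2rδ (by linarith)
    have hp : 0 ≤ r ^ (s - 1 / 2) := by positivity
    have hr2 : 0 ≤ √r := Real.sqrt_nonneg r
    have hs2 : 1 ≤ √2 := Real.one_le_sqrt.2 (by norm_num)
    have hδi : 0 ≤ 1 / √δ := by positivity
    have hcq : 0 ≤ c / (q - 1) := by positivity
    have hpos : 0 ≤ √(2 * r) * (A - c / (q - 1) * (2 * r) ^ (s - 1 / 2)) := by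
      refine mul_nonneg (Real.sqrt_nonneg _) ?_
      rw [h2σ, hA]
      nlinarith [mul_le_mul_of_nonneg_left hrδσ hcq]
    have hbound : √(2 * r) * (A - c / (q - 1) * (2 * r) ^ (s - 1 / 2)) +
        2 * (2 * Real.pi * r) ^ s ≤ √2 * (√r * (A - c / (q - 1) * r ^ (s - 1 / 2))) := by
      rw [h2σ, Real.mul_rpow (by positivity) hr0.le, hσ, Real.sqrt_mul (by norm_num), ← mul_assoc 2,
        ← hc]
      have hcc : c = c / (q - 1) * (q - 1) := by field_simp
      have h6 : 0 ≤ (√2 - 1) * (c * (√r * r ^ (s - 1 / 2))) :=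
        mul_nonneg (by linarith) (by positivity)
      have h7 : √2 * √r * (A - c / (q - 1) * (q * r ^ (s - 1 / 2))) =
          √2 * (√r * (A - c / (q - 1) * r ^ (s - 1 / 2))) -
            √2 * √r * (c / (q - 1) * (q - 1)) * r ^ (s - 1 / 2) := by ring
      rw [h7, ← hcc]
      linarith
    rw [← add_mul, ← ENNReal.ofReal_add hpos (by positivity)] at hchain
    replace hchain := hchain.trans (mul_le_mul' (ENNReal.ofReal_le_ofReal hbound) le_rfl)
    rw [ENNReal.ofReal_mul (Real.sqrt_nonneg 2), mul_assoc] at hchain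
    exact (ENNReal.mul_le_mul_iff_right (by simp) ENNReal.ofReal_ne_top).1 hchain

end Strip

/-- The averages of a continuous nonnegative function over short intervals to the right of `0`
recover its value at `0`. -/
theorem le_liminf_average_Ioo {f : ℝ → ℝ≥0∞} (hf : Continuous f) {r : ℕ → ℝ} (hr : ∀ k, 0 < r k)
    (hr0 : Tendsto r atTop (𝓝 0)) :
    f 0 ≤ liminf (fun k => ENNReal.ofReal (r k)⁻¹ * ∫⁻ t in Ioo 0 (r k), f t) atTop := by
  refine le_of_forall_lt_imp_le_of_dense fun a ha => le_liminf_of_le (by isBoundedDefault) ?_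
  obtain ⟨ε, hε, hball⟩ := Metric.mem_nhds_iff.1 (hf.continuousAt.eventually_const_lt ha)
  filter_upwards [hr0.eventually_lt_const hε] with k hk
  calc a = ENNReal.ofReal (r k)⁻¹ * ∫⁻ _ in Ioo 0 (r k), a := by
        rw [setLIntegral_const, Real.volume_Ioo, sub_zero, mul_left_comm,
          ← ENNReal.ofReal_mul (inv_nonneg.2 (hr k).le), inv_mul_cancel₀ (hr k).ne',
          ENNReal.ofReal_one, mul_one]
    _ ≤ _ := by
        refine mul_le_mul' le_rfl (setLIntegral_mono' measurableSet_Ioo fun t ht => ?_)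
        refine le_of_lt (hball ?_)
        rw [Metric.mem_ball, Real.dist_eq, sub_zero, abs_of_pos ht.1]
        exact ht.2.trans hk

/-- The trace inequality on a piece of the boundary that is a Lipschitz graph. -/
theorem exists_setLIntegral_graph_le {d : ℕ} {Ω : Set (Eucl d)} {e : Eucl d} {h : Eucl d → ℝ}
    {T : Set (Eucl d)} {δ s : ℝ} {K : ℝ≥0} (he : ‖e‖ = 1) (hh : LipschitzWith K h)
    (hT : MeasurableSet T) (hT0 : ∀ x ∈ T, graphHeight e h x = 0) (hδ : 0 < δ)
    (hTΩ : ∀ x ∈ T, ∀ t ∈ Ioo 0 δ, x + t • e ∈ Ω) (hΩ : MeasurableSet Ω)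
    (hs : 1 / 2 < s) (hs1 : s ≤ 1) :
    ∃ C : ℝ≥0, ∀ φ : Eucl d → ℂ, Continuous φ → ∀ U : Lp ℂ 2 (volume : Measure (Eucl d)),
      U =ᵐ[volume.restrict Ω] φ →
        ∫⁻ x in T, ‖φ x‖ₑ ^ 2 ∂(Measure.euclideanHausdorffMeasure (d - 1)) ≤
          C * sobolevENorm s U ^ 2 := by
  set B : ℝ := 2 * (2 * Real.pi) ^ s / (2 ^ (s - 1 / 2) - 1) with hB
  have hB0 : 0 ≤ B := by
    have : (0 : ℝ) < 2 ^ (s - 1 / 2) - 1 :=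
      sub_pos.2 (Real.one_lt_rpow (by norm_num) (by linarith))
    positivity
  set A : ℝ := B * δ ^ (s - 1 / 2) + 1 / √δ with hA
  refine ⟨(1 + K) ^ (d - 1) * Real.toNNReal (A ^ 2), fun φ hφ U hU => ?_⟩
  set r : ℕ → ℝ := fun k => δ / 2 ^ k with hr
  have hr0 : ∀ k, 0 < r k := fun k => by positivity
  have hrlim : Tendsto r atTop (𝓝 0) :=
    tendsto_const_nhds.div_atTop (tendsto_pow_atTop_atTop_of_one_lt (by norm_num))
  have hF : Continuous fun x => ‖φ x‖ₑ ^ 2 := by fun_prop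
  have hM : ∀ k, ∫⁻ x in T, (ENNReal.ofReal (r k)⁻¹ * ∫⁻ t in Ioo 0 (r k), ‖φ (x + t • e)‖ₑ ^ 2)
      ∂(Measure.euclideanHausdorffMeasure (d - 1)) ≤
        ((1 + K) ^ (d - 1) * Real.toNNReal (A ^ 2) : ℝ≥0) * sobolevENorm s U ^ 2 := by
    intro k
    rw [lintegral_const_mul' _ _ ENNReal.ofReal_ne_top]
    have h1 := setLIntegral_graph_le he hh hT hT0 (r k) hF.measurable
    rw [← eLpNorm_two_sq] at h1
    have h2 : eLpNorm φ 2 (volume.restrict (graphStrip e h T 0 (r k))) ≤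
        ENNReal.ofReal (√(r k) * A) * sobolevENorm s U := by
      refine (eLpNorm_graphStrip_le he hh.continuous hT hδ hTΩ hΩ hs hs1 hφ hU k).trans ?_
      gcongr
      have : 0 ≤ B * (r k) ^ (s - 1 / 2) := mul_nonneg hB0 (by have := hr0 k; positivity)
      exact sub_le_self _ this
    calc ENNReal.ofReal (r k)⁻¹ * _
        ≤ ENNReal.ofReal (r k)⁻¹ * (((1 + K) ^ (d - 1) : ℝ≥0) *
          (ENNReal.ofReal (√(r k) * A) * sobolevENorm s U) ^ 2) := by
          refine mul_le_mul' le_rfl (h1.trans ?_)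
          gcongr
      _ = ((1 + K) ^ (d - 1) : ℝ≥0) * (ENNReal.ofReal (r k)⁻¹ *
          ENNReal.ofReal (√(r k) * A) ^ 2) * sobolevENorm s U ^ 2 := by ring
      _ = _ := by
          have hA0 : 0 ≤ A := by positivity
          rw [← ENNReal.ofReal_pow (by positivity), ← ENNReal.ofReal_mul (by
            have := hr0 k; positivity), mul_pow, Real.sq_sqrt (hr0 k).le,
            inv_mul_cancel_left₀ (hr0 k).ne', ENNReal.coe_mul]
          rfl
  calc ∫⁻ x in T, ‖φ x‖ₑ ^ 2 ∂(Measure.euclideanHausdorffMeasure (d - 1))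
      ≤ ∫⁻ x in T, liminf (fun k => ENNReal.ofReal (r k)⁻¹ *
          ∫⁻ t in Ioo 0 (r k), ‖φ (x + t • e)‖ₑ ^ 2) atTop
          ∂(Measure.euclideanHausdorffMeasure (d - 1)) := by
        refine lintegral_mono fun x => ?_
        have := le_liminf_average_Ioo (f := fun t => ‖φ (x + t • e)‖ₑ ^ 2) (by fun_prop) hr0 hrlim
        simpa using this
    _ ≤ liminf (fun k => ∫⁻ x in T, (ENNReal.ofReal (r k)⁻¹ *
          ∫⁻ t in Ioo 0 (r k), ‖φ (x + t • e)‖ₑ ^ 2)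
          ∂(Measure.euclideanHausdorffMeasure (d - 1))) atTop := by
        refine lintegral_liminf_le fun k => Measurable.const_mul ?_ _
        refine Measurable.lintegral_prod_right'
          (f := fun p : Eucl d × ℝ => ‖φ (p.1 + p.2 • e)‖ₑ ^ 2) ?_
        exact hF.measurable.comp (by fun_prop)
    _ ≤ _ := liminf_le_of_frequently_le' (Frequently.of_forall hM)

section Trace

variable {d : ℕ} {Ω : Set (Eucl d)}

theorem IsBoundedLipschitzDomain.isCompact_frontier (hΩ : IsBoundedLipschitzDomain Ω) :
    IsCompact (frontier Ω) :=
  Metric.isCompact_of_isClosed_isBounded isClosed_frontier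
    (hΩ.isBounded.closure.subset frontier_subset_closure)

/-- The local trace inequality at a boundary point. The height function of the local graph vanishes
on the boundary, and short vertical segments starting there stay inside the domain. -/
theorem IsBoundedLipschitzDomain.exists_setLIntegral_nhds_le (hΩ : IsBoundedLipschitzDomain Ω)
    {s : ℝ} (hs : 1 / 2 < s) (hs1 : s ≤ 1) {p : Eucl d} (hp : p ∈ frontier Ω) :
    ∃ V ∈ 𝓝 p, ∃ C : ℝ≥0, ∀ φ : Eucl d → ℂ, Continuous φ →
      ∀ U : Lp ℂ 2 (volume : Measure (Eucl d)), U =ᵐ[volume.restrict Ω] φ →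
        ∫⁻ x in V ∩ frontier Ω, ‖φ x‖ₑ ^ 2 ∂(Measure.euclideanHausdorffMeasure (d - 1)) ≤
          C * sobolevENorm s U ^ 2 := by
  obtain ⟨O, e, h, K, hO, hpO, he, hh, hgraph⟩ := hΩ.exists_graph p hp
  obtain ⟨ρ, hρ, hρO⟩ := Metric.isOpen_iff.1 hO p hpO
  have hpos : ∀ x ∈ O, x ∈ Ω ↔ 0 < graphHeight e h x := fun x hx => by
    rw [hgraph x hx, graphHeight, sub_pos]
  have h0 : ∀ x ∈ O ∩ frontier Ω, graphHeight e h x = 0 := by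
    rintro x ⟨hxO, hxΓ⟩
    refine le_antisymm (not_lt.1 fun hlt => ?_) ?_
    · exact (hΩ.isOpen.frontier_eq ▸ hxΓ).2 ((hpos x hxO).2 hlt)
    · have h1 : x ∈ closure (O ∩ Ω) := by
        have := hO.inter_closure (t := Ω)
        exact this ⟨hxO, frontier_subset_closure hxΓ⟩
      have h2 : closure (O ∩ Ω) ⊆ {y | 0 ≤ graphHeight e h y} :=
        closure_minimal (fun y hy => ((hpos y hy.1).1 hy.2).le)
          (isClosed_le continuous_const (continuous_graphHeight hh.continuous))
      exact h2 h1
  have hsub : Metric.ball p (ρ / 2) ⊆ O :=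
    (Metric.ball_subset_ball (by linarith)).trans hρO
  refine ⟨Metric.ball p (ρ / 2), Metric.ball_mem_nhds p (by positivity), ?_⟩
  refine exists_setLIntegral_graph_le (δ := ρ / 2) he hh
    (Metric.isOpen_ball.measurableSet.inter isClosed_frontier.measurableSet)
    (fun x hx => h0 x ⟨hsub hx.1, hx.2⟩) (by positivity) ?_ hΩ.isOpen.measurableSet hs hs1
  intro x hx t ht
  have hxt : x + t • e ∈ O := by
    refine hρO ?_
    have h1 : dist (x + t • e) x = t := by
      rw [dist_eq_norm, add_sub_cancel_left, norm_smul, he, mul_one, Real.norm_of_nonneg ht.1.le]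
    have h2 := Metric.mem_ball.1 hx.1
    rw [Metric.mem_ball]
    linarith [dist_triangle (x + t • e) x p, ht.2]
  rw [hpos _ hxt, graphHeight_add_smul he, h0 x ⟨hsub hx.1, hx.2⟩, zero_add]
  exact ht.1

/-- The trace inequality: on functions that are continuous up to the boundary, the norm of the
boundary values in `L²(Γ)` is bounded by the norm in `H^s(Ω)`, `s > 1/2`. -/
theorem IsBoundedLipschitzDomain.exists_eLpNorm_surfaceMeasure_le
    (hΩ : IsBoundedLipschitzDomain Ω) {s : ℝ} (hs : 1 / 2 < s) :
    ∃ C : ℝ≥0, ∀ φ : Eucl d → ℂ, Continuous φ →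
      eLpNorm φ 2 (surfaceMeasure Ω) ≤ C * sobolevENormOn Ω s φ := by
  have hs' : 1 / 2 < min s 1 := lt_min hs (by norm_num)
  obtain ⟨C, hC⟩ : ∃ C : ℝ≥0, ∀ φ : Eucl d → ℂ, Continuous φ →
      ∀ U : Lp ℂ 2 (volume : Measure (Eucl d)), U =ᵐ[volume.restrict Ω] φ →
        ∫⁻ x in frontier Ω ∩ frontier Ω, ‖φ x‖ₑ ^ 2
          ∂(Measure.euclideanHausdorffMeasure (d - 1)) ≤ C * sobolevENorm (min s 1) U ^ 2 := by
    refine hΩ.isCompact_frontier.induction_on (p := fun S => ∃ C : ℝ≥0, ∀ φ : Eucl d → ℂ,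
      Continuous φ → ∀ U : Lp ℂ 2 (volume : Measure (Eucl d)), U =ᵐ[volume.restrict Ω] φ →
        ∫⁻ x in S ∩ frontier Ω, ‖φ x‖ₑ ^ 2 ∂(Measure.euclideanHausdorffMeasure (d - 1)) ≤
          C * sobolevENorm (min s 1) U ^ 2) ?_ ?_ ?_ ?_
    · exact ⟨0, by simp⟩
    · rintro S S' hSS ⟨C, hC⟩
      exact ⟨C, fun φ hφ U hU => (lintegral_mono_set (inter_subset_inter_left _ hSS)).trans
        (hC φ hφ U hU)⟩
    · rintro S S' ⟨C, hC⟩ ⟨C', hC'⟩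
      refine ⟨C + C', fun φ hφ U hU => ?_⟩
      rw [union_inter_distrib_right, ENNReal.coe_add, add_mul]
      exact (lintegral_union_le _ _ _).trans (add_le_add (hC φ hφ U hU) (hC' φ hφ U hU))
    · intro p hp
      obtain ⟨V, hV, hV'⟩ := hΩ.exists_setLIntegral_nhds_le hs' (min_le_right _ _) hp
      exact ⟨V, mem_nhdsWithin_of_mem_nhds hV, hV'⟩
  -- Adding `1` makes the constant nonzero, so that multiplication by it commutes with the infimum
  -- over all extensions even where that infimum is infinite.
  refine ⟨NNReal.sqrt C + 1, fun φ hφ => ?_⟩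
  have hne : ((NNReal.sqrt C + 1 : ℝ≥0) : ℝ≥0∞) ≠ 0 := by simp
  unfold sobolevENormOn
  simp only [ENNReal.mul_iInf' (a := ((NNReal.sqrt C + 1 : ℝ≥0) : ℝ≥0∞))
    (fun h => absurd h ENNReal.coe_ne_top) (fun h => absurd h hne)]
  refine le_iInf₂ fun U hU => ?_
  rw [← ENNReal.pow_le_pow_left_iff two_ne_zero, eLpNorm_two_sq, surfaceMeasure]
  have h1 := hC φ hφ U hU
  rw [inter_self] at h1
  refine h1.trans ?_
  rw [mul_pow]
  gcongr
  · norm_cast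
    calc C = NNReal.sqrt C ^ 2 := (NNReal.sq_sqrt C).symm
      _ ≤ (NNReal.sqrt C + 1) ^ 2 := by gcongr; exact le_self_add
  · exact sobolevENorm_mono (min_le_left _ _) U

/-! ### The trace operator -/

theorem sobolevENormOn_schwartz_lt_top (s : ℝ) (φ : 𝓢(Eucl d, ℂ)) : sobolevENormOn Ω s φ < ⊤ := by
  have h := sobolevENorm_toLp_lt_top s φ
  refine lt_of_le_of_lt ?_ h
  unfold sobolevENormOn
  exact iInf₂_le (φ.toLp 2 volume) (ae_restrict_of_ae (φ.coeFn_toLp 2 volume))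

/-- Apply the trace inequality to the constant function `1`. -/
theorem IsBoundedLipschitzDomain.isFiniteMeasure_surfaceMeasure
    (hΩ : IsBoundedLipschitzDomain Ω) : IsFiniteMeasure (surfaceMeasure Ω) := by
  obtain ⟨C, hC⟩ := hΩ.exists_eLpNorm_surfaceMeasure_le (s := 1) (by norm_num)
  obtain ⟨R, hR, hΩR⟩ := hΩ.isBounded.subset_closedBall_lt 0 (0 : Eucl d)
  let f : ContDiffBump (0 : Eucl d) := ⟨R, R + 1, hR, by linarith⟩
  have hfc : ContDiff ℝ (⊤ : ℕ∞) fun x : Eucl d => (f x : ℂ) :=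
    Complex.ofRealCLM.contDiff.comp f.contDiff
  have hfs : HasCompactSupport fun x : Eucl d => (f x : ℂ) :=
    f.hasCompactSupport.comp_left (g := fun t : ℝ => (t : ℂ)) Complex.ofReal_zero
  have h1 : sobolevENormOn Ω 1 (fun _ => (1 : ℂ)) =
      sobolevENormOn Ω 1 (hfs.toSchwartzMap hfc) := by
    refine sobolevENormOn_congr 1 ?_
    filter_upwards [ae_restrict_mem hΩ.isOpen.measurableSet] with x hx
    change (1 : ℂ) = (f x : ℂ)
    rw [f.one_of_mem_closedBall (hΩR hx), Complex.ofReal_one]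
  have h2 : eLpNorm (fun _ : Eucl d => (1 : ℂ)) 2 (surfaceMeasure Ω) < ⊤ := by
    refine lt_of_le_of_lt (hC _ continuous_const) (ENNReal.mul_lt_top ENNReal.coe_lt_top ?_)
    rw [h1]
    exact sobolevENormOn_schwartz_lt_top 1 _
  have h3 := eLpNorm_two_sq (fun _ : Eucl d => (1 : ℂ)) (surfaceMeasure Ω)
  simp only [enorm_one, one_pow, lintegral_const, one_mul] at h3
  refine ⟨?_⟩
  rw [← h3]
  exact ENNReal.pow_lt_top h2

/-- `g` is a trace of `u` that is obtained by approximation in `H^s(Ω)`. -/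
def HasTraceOfOrder (Ω : Set (Eucl d)) (s : ℝ) (u : L2Dom Ω) (g : L2Bdry Ω) : Prop :=
  ∃ φ : ℕ → 𝓢(Eucl d, ℂ),
    Tendsto (fun n => sobolevENormOn Ω s (fun x => φ n x - u x)) atTop (𝓝 0) ∧
    Tendsto (fun n => eLpNorm (fun x => φ n x - g x) 2 (surfaceMeasure Ω)) atTop (𝓝 0)

theorem IsBoundedLipschitzDomain.exists_enorm_le_of_hasTraceOfOrder
    (hΩ : IsBoundedLipschitzDomain Ω) {s : ℝ} (hs : 1 / 2 < s) :
    ∃ C : ℝ≥0, ∀ (u : L2Dom Ω) (g : L2Bdry Ω), HasTraceOfOrder Ω s u g →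
      ‖g‖ₑ ≤ C * sobolevENormOn Ω s u := by
  obtain ⟨C, hC⟩ := hΩ.exists_eLpNorm_surfaceMeasure_le hs
  refine ⟨C, ?_⟩
  rintro u g ⟨φ, h1, h2⟩
  have h3 : ∀ n, ‖g‖ₑ ≤ C * (sobolevENormOn Ω s (fun x => φ n x - u x) + sobolevENormOn Ω s u) +
      eLpNorm (fun x => φ n x - g x) 2 (surfaceMeasure Ω) := by
    intro n
    have hm := (φ n).continuous.aestronglyMeasurable (μ := surfaceMeasure Ω)
    calc ‖g‖ₑ = eLpNorm ((φ n : Eucl d → ℂ) - fun x => φ n x - g x) 2 (surfaceMeasure Ω) := by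
          rw [Lp.enorm_def]
          congr 1
          ext x
          simp
      _ ≤ eLpNorm (φ n) 2 (surfaceMeasure Ω) +
          eLpNorm (fun x => φ n x - g x) 2 (surfaceMeasure Ω) :=
        eLpNorm_sub_le hm (hm.sub (Lp.aestronglyMeasurable g)) (by norm_num)
      _ ≤ _ := by
        gcongr
        refine (hC _ (φ n).continuous).trans ?_
        gcongr
        refine le_trans (le_of_eq ?_) (sobolevENormOn_add_le Ω s (fun x => φ n x - u x) u)
        congr 1
        ext x
        simp
  have h4 := (ENNReal.Tendsto.const_mul (h1.add_const (sobolevENormOn Ω s u))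
    (Or.inr (ENNReal.coe_ne_top (r := C)))).add h2
  rw [zero_add, add_zero] at h4
  exact ge_of_tendsto' h4 h3

theorem sobolevENormOn_zero (Ω : Set (Eucl d)) (s : ℝ) : sobolevENormOn Ω s (0 : L2Dom Ω) = 0 := by
  have h1 := sobolevENormOn_smul_le Ω s 0 (0 : Eucl d → ℂ)
  rw [zero_smul, enorm_zero, zero_mul] at h1
  rw [sobolevENormOn_congr s (Lp.coeFn_zero ℂ 2 ((volume : Measure (Eucl d)).restrict Ω))]
  exact le_antisymm h1 zero_le

theorem IsBoundedLipschitzDomain.hasTrace_unique (hΩ : IsBoundedLipschitzDomain Ω)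
    {u : L2Dom Ω} {g g' : L2Bdry Ω} (h : HasTrace Ω u g) (h' : HasTrace Ω u g') : g = g' := by
  have h1 : HasTrace Ω 0 (g - g') := by
    simpa [sub_eq_add_neg] using h.add (h'.smul (-1))
  obtain ⟨s, hs, hφ⟩ := h1
  obtain ⟨C, hC⟩ := hΩ.exists_enorm_le_of_hasTraceOfOrder hs
  have h2 := hC _ _ hφ
  rw [sobolevENormOn_zero, mul_zero, nonpos_iff_eq_zero, enorm_eq_zero, sub_eq_zero] at h2
  exact h2

theorem IsBoundedLipschitzDomain.memLp_surfaceMeasure (hΩ : IsBoundedLipschitzDomain Ω)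
    (φ : 𝓢(Eucl d, ℂ)) : MemLp φ 2 (surfaceMeasure Ω) := by
  obtain ⟨C, hC⟩ := hΩ.exists_eLpNorm_surfaceMeasure_le (s := 1) (by norm_num)
  exact ⟨φ.continuous.aestronglyMeasurable, (hC φ φ.continuous).trans_lt
    (ENNReal.mul_lt_top ENNReal.coe_lt_top (sobolevENormOn_schwartz_lt_top 1 φ))⟩

/-- Schwartz functions are dense in `H^s(Ω)`. -/
theorem exists_schwartz_sobolevENormOn_sub_lt {s : ℝ} {u : L2Dom Ω}
    (hu : sobolevENormOn Ω s u < ⊤) {ε : ℝ≥0∞} (hε : 0 < ε) :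
    ∃ φ : 𝓢(Eucl d, ℂ), sobolevENormOn Ω s (fun x => φ x - u x) < ε := by
  unfold sobolevENormOn at hu
  simp only [iInf_lt_iff] at hu
  obtain ⟨U, hU, hUs⟩ := hu
  obtain ⟨ψ, hψ⟩ := exists_schwartz_sobolevENorm_sub_lt s hUs hε
  refine ⟨ψ, (iInf₂_le (ψ.toLp 2 volume - U) ?_).trans_lt hψ⟩
  filter_upwards [ae_restrict_of_ae (Lp.coeFn_sub (ψ.toLp 2 volume) U),
    ae_restrict_of_ae (ψ.coeFn_toLp 2 volume), hU] with x h1 h2 h3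
  rw [h1, Pi.sub_apply, h2, h3]

/-- The boundary values of approximating Schwartz functions form a Cauchy sequence by the trace
inequality. -/
theorem IsBoundedLipschitzDomain.exists_hasTraceOfOrder (hΩ : IsBoundedLipschitzDomain Ω) {s : ℝ}
    (hs : 1 / 2 < s) {u : L2Dom Ω} (hu : sobolevENormOn Ω s u < ⊤) :
    ∃ g, HasTraceOfOrder Ω s u g := by
  obtain ⟨C, hC⟩ := hΩ.exists_eLpNorm_surfaceMeasure_le hs
  have hpos : ∀ n : ℕ, (0 : ℝ≥0∞) < ENNReal.ofReal ((1 / 2) ^ n) := fun n =>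
    ENNReal.ofReal_pos.2 (by positivity)
  choose φ hφ using fun n : ℕ => exists_schwartz_sobolevENormOn_sub_lt hu (hpos n)
  set γ : ℕ → L2Bdry Ω := fun n => (hΩ.memLp_surfaceMeasure (φ n)).toLp with hγ
  have hdist : ∀ n, dist (γ n) (γ (n + 1)) ≤ (2 * C : ℝ) * (1 / 2) ^ n := by
    intro n
    rw [dist_eq_norm, ← ENNReal.ofReal_le_ofReal_iff (by positivity), ofReal_norm, Lp.enorm_def]
    calc eLpNorm (γ n - γ (n + 1) : L2Bdry Ω) 2 (surfaceMeasure Ω)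
        = eLpNorm (fun x => φ n x - φ (n + 1) x) 2 (surfaceMeasure Ω) := by
          refine eLpNorm_congr_ae ?_
          filter_upwards [Lp.coeFn_sub (γ n) (γ (n + 1)),
            (hΩ.memLp_surfaceMeasure (φ n)).coeFn_toLp,
            (hΩ.memLp_surfaceMeasure (φ (n + 1))).coeFn_toLp] with x h1 h2 h3
          rw [h1, Pi.sub_apply, h2, h3]
      _ ≤ C * sobolevENormOn Ω s (fun x => φ n x - φ (n + 1) x) :=
          hC _ ((φ n).continuous.sub (φ (n + 1)).continuous)
      _ ≤ C * (ENNReal.ofReal ((1 / 2) ^ n) + ENNReal.ofReal ((1 / 2) ^ n)) := by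
          gcongr
          have e1 : (fun x => φ n x - φ (n + 1) x) =
              (fun x => φ n x - u x) + (-1 : ℂ) • fun x => φ (n + 1) x - u x := by
            ext x
            simp
          rw [e1]
          refine (sobolevENormOn_add_le _ _ _ _).trans (add_le_add (hφ n).le ?_)
          refine (sobolevENormOn_smul_le _ _ _ _).trans ?_
          rw [enorm_neg, enorm_one, one_mul]
          refine (hφ (n + 1)).le.trans (ENNReal.ofReal_le_ofReal ?_)
          exact pow_le_pow_of_le_one (by norm_num) (by norm_num) n.le_succ
      _ = _ := by
          rw [ENNReal.ofReal_mul (by positivity), ENNReal.ofReal_mul (by norm_num),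
            ENNReal.ofReal_coe_nnreal, ENNReal.ofReal_ofNat]
          ring
  obtain ⟨g, hg⟩ := cauchySeq_tendsto_of_complete
    (cauchySeq_of_le_geometric (1 / 2) (2 * C : ℝ) (by norm_num) hdist)
  refine ⟨g, φ, ?_, ?_⟩
  · have h0 : Tendsto (fun n : ℕ => ENNReal.ofReal ((1 / 2) ^ n)) atTop (𝓝 0) := by
      rw [← ENNReal.ofReal_zero]
      exact ENNReal.tendsto_ofReal
        (tendsto_pow_atTop_nhds_zero_of_lt_one (by norm_num) (by norm_num))
    exact tendsto_of_tendsto_of_tendsto_of_le_of_le tendsto_const_nhds h0 (fun _ => zero_le)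
      fun n => (hφ n).le
  · refine ((Lp.tendsto_Lp_iff_tendsto_eLpNorm' γ g).1 hg).congr fun n => eLpNorm_congr_ae ?_
    filter_upwards [(hΩ.memLp_surfaceMeasure (φ n)).coeFn_toLp] with x h1
    rw [Pi.sub_apply, hγ, h1]

/-- Boundedness of the trace as an operator from `H^s(Ω)` to `L²(Γ)`. -/
theorem IsBoundedLipschitzDomain.exists_enorm_trace_le (hΩ : IsBoundedLipschitzDomain Ω) {s : ℝ}
    (hs : 1 / 2 < s) : ∃ C : ℝ≥0, ∀ (u : L2Dom Ω) (g : L2Bdry Ω), sobolevENormOn Ω s u < ⊤ →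
      HasTrace Ω u g → ‖g‖ₑ ≤ C * sobolevENormOn Ω s u := by
  obtain ⟨C, hC⟩ := hΩ.exists_enorm_le_of_hasTraceOfOrder hs
  refine ⟨C, fun u g hu hg => ?_⟩
  obtain ⟨g', hg'⟩ := hΩ.exists_hasTraceOfOrder hs hu
  rw [hΩ.hasTrace_unique hg ⟨s, hs, hg'⟩]
  exact hC u g' hg'

theorem IsBoundedLipschitzDomain.hasTrace_schwartz (hΩ : IsBoundedLipschitzDomain Ω)
    (φ : 𝓢(Eucl d, ℂ)) : HasTrace Ω (((φ.memLp 2 volume).restrict Ω).toLp)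
      ((hΩ.memLp_surfaceMeasure φ).toLp) := by
  refine ⟨1, by norm_num, fun _ => φ, tendsto_const_nhds.congr fun _ => ?_,
    tendsto_const_nhds.congr fun _ => ?_⟩
  · rw [← sobolevENormOn_zero Ω 1]
    refine sobolevENormOn_congr 1 ?_
    filter_upwards [((φ.memLp 2 volume).restrict Ω).coeFn_toLp,
      Lp.coeFn_zero ℂ 2 ((volume : Measure (Eucl d)).restrict Ω)] with x h1 h2
    rw [h1, h2, sub_self]; rfl
  · rw [← eLpNorm_zero (μ := surfaceMeasure Ω) (p := 2) (ε := ℂ)]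
    refine eLpNorm_congr_ae ?_
    filter_upwards [(hΩ.memLp_surfaceMeasure φ).coeFn_toLp] with x h1
    rw [h1, sub_self]; rfl

/-- The boundary values of Schwartz functions are dense in `L²(Γ)`. -/
theorem IsBoundedLipschitzDomain.exists_schwartz_dist_lt (hΩ : IsBoundedLipschitzDomain Ω)
    (g : L2Bdry Ω) {ε : ℝ} (hε : 0 < ε) :
    ∃ φ : 𝓢(Eucl d, ℂ), dist g (hΩ.memLp_surfaceMeasure φ).toLp < ε := by
  have := hΩ.isFiniteMeasure_surfaceMeasure
  have hd := SchwartzMap.denseRange_toLpCLM (E := Eucl d) (F := ℂ) (p := 2)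
    (μ := surfaceMeasure Ω) ENNReal.ofNat_ne_top
  obtain ⟨φ, hφ⟩ := hd.exists_dist_lt g hε
  exact ⟨φ, hφ⟩

end Trace

/-! ### The Hilbert space structure on the domain of a form -/

section Forms

variable {H : Type*} [NormedAddCommGroup H] [InnerProductSpace ℂ H]

/-- The supremum defining the maximal semi-bound is attained. On the zero space every real number
is a semi-bound, and the supremum is `0` by convention. -/
theorem SesqForm.maxSemiBound_mem {b : SesqForm H} (hb : b.semiBounds.Nonempty) :
    b.maxSemiBound ∈ b.semiBounds := by
  intro u
  rcases eq_or_ne (u : H) 0 with hu | hu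
  · have : u = 0 := Subtype.ext hu
    simp [this]
  · have hpos : 0 < ‖(u : H)‖ ^ 2 := by positivity
    rw [← le_div_iff₀ hpos]
    exact csSup_le hb fun l hl => (le_div_iff₀ hpos).2 (hl u)

/-- The domain of a form, as a type without the norm of the ambient space. -/
def FormSpace (b : SesqForm H) : Type _ := b.dom

instance (b : SesqForm H) : AddCommGroup (FormSpace b) := inferInstanceAs (AddCommGroup b.dom)

instance (b : SesqForm H) : Module ℂ (FormSpace b) := inferInstanceAs (Module ℂ b.dom)

/-- The identity between the two versions of the form domain. -/
def FormSpace.equiv (b : SesqForm H) : FormSpace b ≃ₗ[ℂ] b.dom := LinearEquiv.refl ℂ b.dom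

/-- The inner product `b(u, v) + (1 - l) ⟨u, v⟩`, with `l` the maximal semi-bound. -/
@[reducible]
noncomputable def FormSpace.core {b : SesqForm H} (hb : b.semiBounds.Nonempty) (hs : b.IsSymm) :
    InnerProductSpace.Core ℂ (FormSpace b) where
  inner v w := b.toFun (equiv b w) (equiv b v) +
    ((1 - b.maxSemiBound : ℝ) : ℂ) * inner ℂ (equiv b v : H) (equiv b w : H)
  conj_inner_symm v w := by
    rw [map_add, map_mul, Complex.conj_ofReal, inner_conj_symm, ← hs]
  re_inner_nonneg v := by
    have h := SesqForm.maxSemiBound_mem hb (equiv b v)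
    have h2 : (inner ℂ (equiv b v : H) (equiv b v : H)) = ((‖(equiv b v : H)‖ ^ 2 : ℝ) : ℂ) := by
      rw [inner_self_eq_norm_sq_to_K]; norm_cast
    rw [h2, ← Complex.ofReal_mul]
    rw [RCLike.re_eq_complex_re, Complex.add_re, Complex.ofReal_re]
    nlinarith [sq_nonneg ‖(equiv b v : H)‖]
  add_left u v w := by
    simp only [map_add, Submodule.coe_add, inner_add_left]
    ring
  smul_left v w c := by
    simp only [map_smulₛₗ, Submodule.coe_smul, inner_smul_left, smul_eq_mul, RingHom.id_apply]
    ring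
  definite v hv := by
    have h := SesqForm.maxSemiBound_mem hb (equiv b v)
    have h2 : (inner ℂ (equiv b v : H) (equiv b v : H)) = ((‖(equiv b v : H)‖ ^ 2 : ℝ) : ℂ) := by
      rw [inner_self_eq_norm_sq_to_K]; norm_cast
    rw [h2, ← Complex.ofReal_mul] at hv
    have h3 := congrArg Complex.re hv
    rw [Complex.add_re, Complex.ofReal_re, Complex.zero_re] at h3
    have h4 : ‖(equiv b v : H)‖ ^ 2 ≤ 0 := by nlinarith
    have h5 : (equiv b v : H) = 0 := by
      rw [← norm_eq_zero]; exact pow_eq_zero_iff two_ne_zero |>.1 (le_antisymm h4 (sq_nonneg _))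
    exact (equiv b).map_eq_zero_iff.1 (Subtype.ext h5)

/-- The domain of a symmetric generating form is a Hilbert space for the form norm. -/
theorem SesqForm.IsGenerating.exists_hilbertSpace {H : Type} [NormedAddCommGroup H]
    [InnerProductSpace ℂ H] {b : SesqForm H} (hb : b.IsGenerating) (hs : b.IsSymm) :
    ∃ (V : Type) (_ : NormedAddCommGroup V) (_ : InnerProductSpace ℂ V) (_ : CompleteSpace V)
      (ι : V ≃ₗ[ℂ] b.dom), (∀ v, ‖v‖ = b.formNorm (ι v)) ∧ (∀ v, ‖(ι v : H)‖ ≤ ‖v‖) ∧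
        ∀ v w, b.toFun (ι v) (ι w) =
          inner ℂ w v - ((1 - b.maxSemiBound : ℝ) : ℂ) * inner ℂ (ι w : H) (ι v : H) := by
  let core := FormSpace.core hb.semibounded hs
  let : NormedAddCommGroup (FormSpace b) := core.toNormedAddCommGroup
  let : InnerProductSpace ℂ (FormSpace b) := InnerProductSpace.ofCore core.toCore
  have hinner : ∀ v w : FormSpace b, inner ℂ v w = b.toFun (FormSpace.equiv b w)
      (FormSpace.equiv b v) + ((1 - b.maxSemiBound : ℝ) : ℂ) *
        inner ℂ (FormSpace.equiv b v : H) (FormSpace.equiv b w : H) := fun v w => rfl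
  have hsq : ∀ v : FormSpace b, ‖v‖ ^ 2 = (b.toFun (FormSpace.equiv b v) (FormSpace.equiv b v)).re +
      (1 - b.maxSemiBound) * ‖(FormSpace.equiv b v : H)‖ ^ 2 := by
    intro v
    have h2 : (inner ℂ (FormSpace.equiv b v : H) (FormSpace.equiv b v : H)) =
        ((‖(FormSpace.equiv b v : H)‖ ^ 2 : ℝ) : ℂ) := by
      rw [inner_self_eq_norm_sq_to_K]; norm_cast
    rw [← inner_self_eq_norm_sq (𝕜 := ℂ) v, hinner, h2, ← Complex.ofReal_mul]
    rw [RCLike.re_eq_complex_re, Complex.add_re, Complex.ofReal_re]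
  have hnorm : ∀ v : FormSpace b, ‖v‖ = b.formNorm (FormSpace.equiv b v) := by
    intro v
    rw [SesqForm.formNorm, ← hsq, Real.sqrt_sq (norm_nonneg v)]
  refine ⟨FormSpace b, inferInstance, inferInstance, ?_, FormSpace.equiv b, hnorm, ?_, ?_⟩
  · refine Metric.complete_of_cauchySeq_tendsto fun u hu => ?_
    obtain ⟨v, hv⟩ := hb.closed (fun n => FormSpace.equiv b (u n)) fun ε hε => by
      obtain ⟨N, hN⟩ := Metric.cauchySeq_iff.1 hu ε hε
      refine ⟨N, fun m hm n hn => ?_⟩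
      rw [← map_sub, ← hnorm, ← dist_eq_norm]
      exact hN m hm n hn
    refine ⟨(FormSpace.equiv b).symm v, tendsto_iff_norm_sub_tendsto_zero.2 (hv.congr fun n => ?_)⟩
    rw [hnorm, map_sub, LinearEquiv.apply_symm_apply]
  · intro v
    refine le_of_sq_le_sq ?_ (norm_nonneg v)
    have h := SesqForm.maxSemiBound_mem hb.semibounded (FormSpace.equiv b v)
    rw [hsq]
    linarith
  · intro v w
    rw [hinner]
    ring

end Forms

/-! ### Graphs of unbounded operators -/

section Graphs

variable {E F : Type*} [NormedAddCommGroup E] [InnerProductSpace ℂ E] [NormedAddCommGroup F]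
  [InnerProductSpace ℂ F]

theorem mem_graph_domRestrict_iff {T : E →ₗ.[ℂ] F} {S : Submodule ℂ E} {x : E} {y : F} :
    (x, y) ∈ (T.domRestrict S).graph ↔ x ∈ S ∧ (x, y) ∈ T.graph := by
  simp only [LinearPMap.mem_graph_iff]
  constructor
  · rintro ⟨z, rfl, rfl⟩
    exact ⟨z.2.1, ⟨z, z.2.2⟩, rfl, (T.domRestrict_apply rfl).symm⟩
  · rintro ⟨hx, z, rfl, rfl⟩
    exact ⟨⟨z, hx, z.2⟩, rfl, T.domRestrict_apply rfl⟩

theorem mem_pker_iff {T : E →ₗ.[ℂ] F} {x : E} : x ∈ pker T ↔ (x, 0) ∈ T.graph := by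
  rw [LinearPMap.mem_graph_iff, pker, Submodule.mem_map]
  constructor
  · rintro ⟨y, hy, rfl⟩
    exact ⟨y, rfl, hy⟩
  · rintro ⟨y, rfl, hy⟩
    exact ⟨y, hy, rfl⟩

/-- The adjoint relation is, up to a rotation, the orthogonal complement of the graph. -/
theorem Submodule.adjoint_adjoint_of_isClosed [CompleteSpace E] [CompleteSpace F]
    {g : Submodule ℂ (E × F)} (hg : IsClosed (g : Set (E × F))) : g.adjoint.adjoint = g := by
  apply le_antisymm
  · intro x hx
    rw [Submodule.mem_adjoint_iff] at hx
    set K : Submodule ℂ (WithLp 2 (E × F)) :=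
      g.comap (WithLp.linearEquiv 2 ℂ (E × F)).toLinearMap with hK
    have hKc : IsClosed (K : Set (WithLp 2 (E × F))) :=
      hg.preimage (WithLp.prod_continuous_ofLp 2 E F)
    have hKK : Kᗮᗮ = K := by
      have : CompleteSpace K := hKc.completeSpace_coe
      exact Submodule.orthogonal_orthogonal K
    have hxK : WithLp.toLp 2 x ∈ Kᗮᗮ := by
      rw [Submodule.mem_orthogonal]
      intro y hy
      rw [Submodule.mem_orthogonal] at hy
      have h1 : (y.snd, -y.fst) ∈ g.adjoint := by
        rw [Submodule.mem_adjoint_iff]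
        intro a c hac
        have h2 := hy (WithLp.toLp 2 (a, c)) hac
        rw [WithLp.prod_inner_apply] at h2
        simp only [inner_neg_right, sub_neg_eq_add]
        rw [add_comm]
        exact h2
      have h3 := hx _ _ h1
      rw [inner_neg_left] at h3
      rw [WithLp.prod_inner_apply]
      change inner ℂ y.fst x.1 + inner ℂ y.snd x.2 = 0
      linear_combination -h3
    rw [hKK] at hxK
    exact hxK
  · intro x hx
    rw [Submodule.mem_adjoint_iff]
    intro a c hac
    rw [Submodule.mem_adjoint_iff] at hac
    have h := congrArg conj (hac x.1 x.2 hx)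
    rw [map_sub, inner_conj_symm, inner_conj_symm, map_zero] at h
    linear_combination -h

end Graphs

/-! ### The trace on the form domain -/

section Model

variable {d : ℕ} {Ω : Set (Eucl d)} {b : SesqForm (L2Dom Ω)}

theorem IsBoundedLipschitzDomain.existsUnique_hasTrace (hΩ : IsBoundedLipschitzDomain Ω)
    (hb : IsAdmissible b) {u : L2Dom Ω} (hu : u ∈ b.dom) : ∃! g, HasTrace Ω u g := by
  obtain ⟨ρ, hρ, -, ⟨C, hC⟩, -⟩ := hb.embedding
  have hs : 1 / 2 < 1 / 2 + ρ := by linarith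
  obtain ⟨g, hg⟩ := hΩ.exists_hasTraceOfOrder hs ((hC ⟨u, hu⟩).trans_lt
    (ENNReal.mul_lt_top ENNReal.coe_lt_top ENNReal.ofReal_lt_top))
  exact ⟨g, ⟨_, hs, hg⟩, fun g' hg' => hΩ.hasTrace_unique hg' ⟨_, hs, hg⟩⟩

/-- The data on which the operator theory rests: the form domain as a Hilbert space `V` with its
continuous embedding `J` into `L²(Ω)` and its trace `τ : V → L²(Γ)`. The form is the inner product
of `V` up to the multiple `c` of the inner product of `L²(Ω)`. -/
structure FormModel (b : SesqForm (L2Dom Ω)) (V : Type) [NormedAddCommGroup V]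
    [InnerProductSpace ℂ V] where
  J : V →L[ℂ] L2Dom Ω
  τ : V →L[ℂ] L2Bdry Ω
  c : ℝ
  injective : Function.Injective J
  mem_dom_iff : ∀ u, u ∈ b.dom ↔ ∃ v, J v = u
  dense_J : DenseRange J
  dense_τ : DenseRange τ
  form_eq : ∀ (v w : V) (hv : J v ∈ b.dom) (hw : J w ∈ b.dom),
    b.toFun ⟨J v, hv⟩ ⟨J w, hw⟩ = inner ℂ w v - (c : ℂ) * inner ℂ (J w) (J v)
  hasTrace_iff : ∀ v g, HasTrace Ω (J v) g ↔ g = τ v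

theorem IsBoundedLipschitzDomain.exists_formModel (hΩ : IsBoundedLipschitzDomain Ω)
    (hb : IsAdmissible b) :
    ∃ (V : Type) (_ : NormedAddCommGroup V) (_ : InnerProductSpace ℂ V) (_ : CompleteSpace V),
      Nonempty (FormModel b V) := by
  obtain ⟨V, i1, i2, i3, ι, hnorm, hle, hform⟩ := hb.generating.exists_hilbertSpace hb.symm
  refine ⟨V, i1, i2, i3, ?_⟩
  obtain ⟨ρ, hρ, -, ⟨C, hC⟩, hdense⟩ := hb.embedding
  have hs : 1 / 2 < 1 / 2 + ρ := by linarith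
  obtain ⟨C', hC'⟩ := hΩ.exists_enorm_trace_le hs
  have hlt : ∀ v : b.dom, sobolevENormOn Ω (1 / 2 + ρ) (v : L2Dom Ω) < ⊤ := fun v =>
    (hC v).trans_lt (ENNReal.mul_lt_top ENNReal.coe_lt_top ENNReal.ofReal_lt_top)
  choose t ht htu using fun v : V => hΩ.existsUnique_hasTrace hb (ι v).2
  let J₀ : V →ₗ[ℂ] L2Dom Ω := b.dom.subtype ∘ₗ ι.toLinearMap
  let t₀ : V →ₗ[ℂ] L2Bdry Ω :=
    { toFun := t
      map_add' := fun v w => by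
        refine (htu _ _ ?_).symm
        rw [map_add]
        exact (ht v).add (ht w)
      map_smul' := fun c v => by
        refine (htu _ _ ?_).symm
        rw [map_smul]
        exact (ht v).smul c }
  have htle : ∀ v, ‖t₀ v‖ ≤ (C' * C : ℝ) * ‖v‖ := by
    intro v
    rw [← ENNReal.ofReal_le_ofReal_iff (by positivity), ofReal_norm, mul_assoc,
      ENNReal.ofReal_mul (by positivity), ENNReal.ofReal_mul (by positivity),
      ENNReal.ofReal_coe_nnreal, ENNReal.ofReal_coe_nnreal, hnorm]
    exact (hC' _ _ (hlt (ι v)) (ht v)).trans (mul_le_mul' le_rfl (hC (ι v)))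
  let J : V →L[ℂ] L2Dom Ω := J₀.mkContinuous 1 fun v => by rw [one_mul]; exact hle v
  let τ : V →L[ℂ] L2Bdry Ω := t₀.mkContinuous _ htle
  have hJ : ∀ v, J v = (ι v : L2Dom Ω) := fun v => rfl
  have hτ : ∀ v, τ v = t v := fun v => rfl
  have hdom : ∀ u, u ∈ b.dom ↔ ∃ v, J v = u := fun u =>
    ⟨fun hu => ⟨ι.symm ⟨u, hu⟩, by rw [hJ, LinearEquiv.apply_symm_apply]⟩, by
      rintro ⟨v, rfl⟩; exact (ι v).2⟩
  refine ⟨⟨J, τ, 1 - b.maxSemiBound, ?_, hdom, ?_, ?_, ?_, ?_⟩⟩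
  · intro v w hvw
    exact ι.injective (Subtype.ext hvw)
  · have : Set.range J = (b.dom : Set (L2Dom Ω)) := by
      ext u
      exact (hdom u).symm
    rw [DenseRange, this]
    exact hb.generating.dense
  · rw [DenseRange, Metric.dense_iff]
    intro g ε hε
    obtain ⟨φ, hφ⟩ := hΩ.exists_schwartz_dist_lt g (half_pos hε)
    set w : L2Dom Ω := ((φ.memLp 2 volume).restrict Ω).toLp with hw
    have hw' : (w : Eucl d → ℂ) =ᵐ[volume.restrict Ω] φ :=
      ((φ.memLp 2 volume).restrict Ω).coeFn_toLp
    have hwlt : sobolevENormOn Ω (1 / 2 + ρ) w < ⊤ := by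
      rw [sobolevENormOn_congr _ hw']
      exact sobolevENormOn_schwartz_lt_top _ φ
    -- Approximate the restriction of `φ` to `Ω` by an element of the form domain.
    have hη : (0 : ℝ≥0∞) < ENNReal.ofReal (ε / 2 / (C' + 1)) :=
      ENNReal.ofReal_pos.2 (by positivity)
    obtain ⟨u, hu⟩ := hdense w hwlt _ hη
    refine ⟨τ (ι.symm u), ?_, mem_range_self _⟩
    have htr : HasTrace Ω (w - (u : L2Dom Ω))
        ((hΩ.memLp_surfaceMeasure φ).toLp - τ (ι.symm u)) := by
      have h1 := (hΩ.hasTrace_schwartz φ).add ((ht (ι.symm u)).smul (-1))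
      rw [LinearEquiv.apply_symm_apply] at h1
      rw [sub_eq_add_neg, sub_eq_add_neg, ← neg_one_smul ℂ (u : L2Dom Ω),
        ← neg_one_smul ℂ (τ (ι.symm u))]
      exact h1
    have hsub : sobolevENormOn Ω (1 / 2 + ρ) (w - (u : L2Dom Ω) : L2Dom Ω) <
        ENNReal.ofReal (ε / 2 / (C' + 1)) := by
      rw [sobolevENormOn_congr _ (Lp.coeFn_sub w (u : L2Dom Ω))]
      exact hu
    have h2 := hC' _ _ (hsub.trans_le le_top) htr
    have h3 : dist (hΩ.memLp_surfaceMeasure φ).toLp (τ (ι.symm u)) ≤ ε / 2 := by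
      rw [dist_eq_norm, ← ENNReal.ofReal_le_ofReal_iff (by positivity), ofReal_norm]
      refine h2.trans ((mul_le_mul' le_rfl hsub.le).trans ?_)
      rw [← ENNReal.ofReal_coe_nnreal, ← ENNReal.ofReal_mul (by positivity)]
      refine ENNReal.ofReal_le_ofReal ?_
      rw [mul_div_assoc', div_le_iff₀ (by positivity)]
      nlinarith [C'.2]
    rw [Metric.mem_ball, dist_comm]
    linarith [dist_triangle g (hΩ.memLp_surfaceMeasure φ).toLp (τ (ι.symm u))]
  · intro v w hv hw
    exact hform v w
  · intro v g
    exact ⟨fun hg => htu v g hg, fun hg => hg ▸ ht v⟩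

end Model

/-! ### The operators associated to an admissible form -/

theorem mem_maximalOp_graph_iff {d : ℕ} {Ω : Set (Eucl d)} {b : SesqForm (L2Dom Ω)}
    (hd : Dense ((minimalOp b).domain : Set (L2Dom Ω)))
    {u f : L2Dom Ω} :
    (u, f) ∈ (maximalOp b).graph ↔
      ∀ v g, (v, g) ∈ (minimalOp b).graph → inner ℂ g u - inner ℂ v f = 0 := by
  rw [maximalOp, LinearPMap.adjoint_graph_eq_graph_adjoint hd, Submodule.mem_adjoint_iff]

namespace FormModel

open ContinuousLinearMap (adjoint)

variable {d : ℕ} {Ω : Set (Eucl d)} {b : SesqForm (L2Dom Ω)} {V : Type} [NormedAddCommGroup V]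
  [InnerProductSpace ℂ V] (m : FormModel b V)

/-- The relation `g = N^b u`, tested on the Hilbert space of the form. -/
theorem isFormNeumannTrace_iff {x : V} {g : L2Bdry Ω} :
    IsFormNeumannTrace b (m.J x) g ↔ ∃ f, (m.J x, f) ∈ (maximalOp b).graph ∧
      ∀ y, inner ℂ (m.J y) f - inner ℂ y x + m.c * inner ℂ (m.J y) (m.J x) =
        inner ℂ (m.τ y) g := by
  constructor
  · rintro ⟨hu, hu', h⟩
    refine ⟨_, (maximalOp b).mem_graph ⟨_, hu'⟩, fun y => ?_⟩
    have hy := (m.mem_dom_iff (m.J y)).2 ⟨y, rfl⟩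
    have h1 := h ⟨m.J y, hy⟩ (m.τ y) ((m.hasTrace_iff _ _).2 rfl)
    rw [m.form_eq] at h1
    change _ = inner ℂ (m.τ y) g at h1
    rw [← h1]
    ring
  · rintro ⟨f, hf, h⟩
    obtain ⟨⟨z, hz⟩, hzx, rfl⟩ := (LinearPMap.mem_graph_iff _).1 hf
    obtain rfl : z = m.J x := hzx
    refine ⟨(m.mem_dom_iff _).2 ⟨x, rfl⟩, hz, ?_⟩
    rintro ⟨v, hv⟩ k hk
    obtain ⟨y, rfl⟩ := (m.mem_dom_iff v).1 hv
    obtain rfl := (m.hasTrace_iff _ _).1 hk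
    rw [m.form_eq]
    have h1 := h y
    change _ = inner ℂ (m.τ y) g
    rw [← h1]
    ring

theorem formNeumannTrace_unique (m : FormModel b V) {u : L2Dom Ω} {g g' : L2Bdry Ω}
    (h : IsFormNeumannTrace b u g) (h' : IsFormNeumannTrace b u g') : g = g' := by
  obtain ⟨x, rfl⟩ := (m.mem_dom_iff u).1 h.1
  obtain ⟨f, hf, h⟩ := m.isFormNeumannTrace_iff.1 h
  obtain ⟨f', hf', h'⟩ := m.isFormNeumannTrace_iff.1 h'
  obtain rfl := LinearPMap.mem_graph_snd_inj _ hf hf' rfl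
  rw [← sub_eq_zero]
  refine m.dense_τ.eq_zero_of_inner_right ℂ fun y => ?_
  rw [inner_sub_right, ← h, ← h', sub_self]

theorem mem_formNeumann_graph_iff (m : FormModel b V) {u : L2Dom Ω} {g : L2Bdry Ω} :
    (u, g) ∈ (formNeumann b).graph ↔ IsFormNeumannTrace b u g := by
  rw [formNeumann, Submodule.toLinearPMap_graph_eq]
  · rfl
  · rintro ⟨x, k⟩ hk (rfl : x = 0)
    exact m.formNeumannTrace_unique hk (formNeumannGraph b).zero_mem

variable [CompleteSpace V]

/-- `J*` is injective because the form is densely defined. -/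
theorem adjoint_injective : Function.Injective (adjoint m.J) := by
  rw [injective_iff_map_eq_zero]
  intro f hf
  refine m.dense_J.eq_zero_of_inner_right ℂ fun v => ?_
  rw [← ContinuousLinearMap.adjoint_inner_right, hf, inner_zero_right]

/-- The range of `J*` is the operator domain `D(B_N)`, which is therefore dense in the form norm. -/
theorem denseRange_adjoint : DenseRange (adjoint m.J) := by
  have h1 : (LinearMap.range (adjoint m.J : L2Dom Ω →ₗ[ℂ] V))ᗮ = ⊥ := by
    rw [eq_bot_iff]
    intro v hv
    rw [Submodule.mem_orthogonal] at hv
    refine m.injective ?_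
    rw [map_zero]
    refine ext_inner_left ℂ fun w => ?_
    rw [inner_zero_right, ← ContinuousLinearMap.adjoint_inner_left]
    exact hv _ ⟨w, rfl⟩
  have h2 := Submodule.dense_iff_topologicalClosure_eq_top.2
    (Submodule.topologicalClosure_eq_top_iff.2 h1)
  exact h2

/-- Since `b(v, w) = ⟨v, w⟩_V - c ⟨v, w⟩`, the relation `B_N u = f` says that `u` represents in `V`
the functional given by `f + c u`. -/
theorem mem_opGraph_iff {u f : L2Dom Ω} :
    (u, f) ∈ b.opGraph ↔ u = m.J (adjoint m.J (f + (m.c : ℂ) • u)) := by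
  constructor
  · rintro ⟨hu, h⟩
    obtain ⟨v, rfl⟩ := (m.mem_dom_iff u).1 hu
    congr 1
    refine ext_inner_left ℂ fun w => ?_
    have hw := (m.mem_dom_iff (m.J w)).2 ⟨w, rfl⟩
    have h1 := h ⟨m.J w, hw⟩
    rw [m.form_eq] at h1
    rw [ContinuousLinearMap.adjoint_inner_right, inner_add_right, inner_smul_right]
    linear_combination h1
  · intro h
    have hu : u ∈ b.dom := (m.mem_dom_iff u).2 ⟨_, h.symm⟩
    refine ⟨hu, ?_⟩
    rintro ⟨w, hw⟩
    obtain ⟨y, rfl⟩ := (m.mem_dom_iff w).1 hw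
    set v := adjoint m.J (f + (m.c : ℂ) • u) with hv
    have h1 : b.toFun ⟨u, hu⟩ ⟨m.J y, hw⟩ = inner ℂ y v - (m.c : ℂ) * inner ℂ (m.J y) u := by
      have hv' : m.J v ∈ b.dom := (m.mem_dom_iff _).2 ⟨_, rfl⟩
      have e : (⟨u, hu⟩ : b.dom) = ⟨m.J v, hv'⟩ := Subtype.ext h
      rw [e, m.form_eq, ← h]
    change b.toFun ⟨u, hu⟩ ⟨m.J y, hw⟩ = inner ℂ (m.J y) f
    rw [h1, hv, ContinuousLinearMap.adjoint_inner_right, inner_add_right, inner_smul_right]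
    ring

/-- The Neumann realization is `A⁻¹ - c`, where `A = J J*`. -/
theorem mem_neumannOp_graph_iff {u f : L2Dom Ω} :
    (u, f) ∈ (neumannOp b).graph ↔ u = m.J (adjoint m.J (f + (m.c : ℂ) • u)) := by
  rw [neumannOp, SesqForm.op, Submodule.toLinearPMap_graph_eq, m.mem_opGraph_iff]
  rintro ⟨x, y⟩ hxy (rfl : x = 0)
  rw [m.mem_opGraph_iff, smul_zero, add_zero] at hxy
  have h1 := m.injective ((map_zero m.J).trans hxy)
  exact m.adjoint_injective (h1.symm.trans (map_zero _).symm)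

theorem neumannOp_graph_eq (m : FormModel b V) : (neumannOp b).graph = b.opGraph := by
  ext ⟨u, f⟩
  rw [m.mem_neumannOp_graph_iff, m.mem_opGraph_iff]

theorem mem_neumannOp_graph (w : L2Dom Ω) : (m.J (adjoint m.J w),
    w - (m.c : ℂ) • m.J (adjoint m.J w)) ∈ (neumannOp b).graph := by
  rw [m.mem_neumannOp_graph_iff, sub_add_cancel]

/-- The minimal operator is the part of the Neumann realization on which the trace vanishes. -/
theorem mem_minimalOp_graph_iff {u f : L2Dom Ω} :
    (u, f) ∈ (minimalOp b).graph ↔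
      (u, f) ∈ (neumannOp b).graph ∧ m.τ (adjoint m.J (f + (m.c : ℂ) • u)) = 0 := by
  rw [minimalOp, mem_graph_domRestrict_iff, and_comm]
  refine and_congr_right fun hN => ?_
  have hu := m.mem_neumannOp_graph_iff.1 hN
  have hdom : u ∈ (dirichletOp b).domain ↔ u ∈ traceKer Ω := by
    change u ∈ (b.restrict (traceKer Ω)).opGraph.map (LinearMap.fst ℂ _ _) ↔ _
    rw [Submodule.mem_map]
    constructor
    · rintro ⟨p, ⟨hp, -⟩, rfl⟩
      exact hp.2
    · intro h0
      obtain ⟨hub, hv⟩ := m.neumannOp_graph_eq.le hN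
      exact ⟨(u, f), ⟨⟨hub, h0⟩, fun v => hv ⟨v, v.2.1⟩⟩, rfl⟩
  rw [hdom]
  change HasTrace Ω u 0 ↔ _
  conv_lhs => rw [hu]
  rw [m.hasTrace_iff, eq_comm]

theorem neumannOp_domain_le (m : FormModel b V) : (neumannOp b).domain ≤ b.dom := by
  intro u hu
  obtain ⟨f, hf⟩ := LinearPMap.mem_domain_iff.1 hu
  exact (m.neumannOp_graph_eq.le hf).1

/-- The Neumann realization contains every pair that is orthogonal to its rotated graph: it is
self-adjoint. -/
theorem mem_neumannOp_graph_of_forall {u f : L2Dom Ω}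
    (h : ∀ w : L2Dom Ω, inner ℂ (w - (m.c : ℂ) • m.J (adjoint m.J w)) u -
      inner ℂ (m.J (adjoint m.J w)) f = 0) : (u, f) ∈ (neumannOp b).graph := by
  rw [m.mem_neumannOp_graph_iff]
  refine ext_inner_left ℂ fun w => ?_
  have h1 := h w
  rw [inner_sub_left, inner_smul_left, Complex.conj_ofReal] at h1
  rw [← ContinuousLinearMap.adjoint_inner_left m.J, ContinuousLinearMap.adjoint_inner_right m.J,
    inner_add_right, inner_smul_right]
  linear_combination h1

/-- The Neumann realization is symmetric. -/
theorem neumannOp_symm (m : FormModel b V) (hs : b.IsSymm) {u f u' f' : L2Dom Ω}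
    (h : (u, f) ∈ (neumannOp b).graph) (h' : (u', f') ∈ (neumannOp b).graph) :
    inner ℂ f u' = inner ℂ u f' := by
  rw [m.neumannOp_graph_eq] at h h'
  obtain ⟨hu, h⟩ := h
  obtain ⟨hu', h'⟩ := h'
  have h1 := h ⟨u', hu'⟩
  have h2 := h' ⟨u, hu⟩
  change _ = inner ℂ u' f at h1
  change _ = inner ℂ u f' at h2
  rw [← h2, ← inner_conj_symm, ← h1, ← hs]

theorem minimalOp_isClosed (m : FormModel b V) : (minimalOp b).IsClosed := by
  have h1 : ((minimalOp b).graph : Set (L2Dom Ω × L2Dom Ω)) =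
      {p | p.1 = m.J (adjoint m.J (p.2 + (m.c : ℂ) • p.1))} ∩
        {p | m.τ (adjoint m.J (p.2 + (m.c : ℂ) • p.1)) = 0} := by
    ext ⟨u, f⟩
    rw [SetLike.mem_coe, m.mem_minimalOp_graph_iff, m.mem_neumannOp_graph_iff]
    rfl
  rw [LinearPMap.IsClosed, h1]
  exact (isClosed_eq (by fun_prop) (by fun_prop)).inter (isClosed_eq (by fun_prop) (by fun_prop))

theorem minimalOp_isFormalAdjoint (m : FormModel b V) (hs : b.IsSymm) :
    (minimalOp b).IsFormalAdjoint (minimalOp b) := fun x y =>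
  m.neumannOp_symm hs (m.mem_minimalOp_graph_iff.1 ((minimalOp b).mem_graph x)).1
    (m.mem_minimalOp_graph_iff.1 ((minimalOp b).mem_graph y)).1

theorem neumannOp_graph_le_maximalOp_graph (m : FormModel b V) (hs : b.IsSymm)
    (hd : Dense ((minimalOp b).domain : Set (L2Dom Ω))) :
    (neumannOp b).graph ≤ (maximalOp b).graph := by
  rintro ⟨u, f⟩ h
  rw [mem_maximalOp_graph_iff hd]
  intro v g hv
  rw [sub_eq_zero]
  exact m.neumannOp_symm hs (m.mem_minimalOp_graph_iff.1 hv).1 h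

/-- The trace of `D(B_N)` is dense: `D(B_N)` is dense in the form norm, and the trace of the form
domain is dense. -/
theorem denseRange_trace_neumannOp : DenseRange fun w => m.τ (adjoint m.J w) :=
  m.dense_τ.comp m.denseRange_adjoint m.τ.continuous

/-- The relation `g = 𝒩^b u`, tested on `D(B_N)`, the range of `J J*`. -/
theorem isOpNeumannTrace_iff {u : L2Dom Ω} {g : L2Bdry Ω} :
    IsOpNeumannTrace b u g ↔ ∃ f, (u, f) ∈ (maximalOp b).graph ∧
      ∀ w, inner ℂ (m.J (adjoint m.J w)) f - inner ℂ (w - (m.c : ℂ) • m.J (adjoint m.J w)) u =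
        inner ℂ (m.τ (adjoint m.J w)) g := by
  constructor
  · rintro ⟨hu, h⟩
    refine ⟨_, (maximalOp b).mem_graph ⟨_, hu⟩, fun w => ?_⟩
    obtain ⟨v, hv, hv'⟩ := (LinearPMap.mem_graph_iff _).1 (m.mem_neumannOp_graph w)
    have h1 := h v (m.τ (adjoint m.J w)) (by rw [hv]; exact (m.hasTrace_iff _ _).2 rfl)
    rw [hv, hv'] at h1
    exact h1
  · rintro ⟨f, hf, h⟩
    obtain ⟨⟨z, hz⟩, hzx, rfl⟩ := (LinearPMap.mem_graph_iff _).1 hf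
    obtain rfl : z = u := hzx
    refine ⟨hz, fun v k hk => ?_⟩
    have hv := m.mem_neumannOp_graph_iff.1 ((neumannOp b).mem_graph v)
    set w := neumannOp b v + (m.c : ℂ) • (v : L2Dom Ω) with hw
    have h1 := h w
    have h2 : neumannOp b v = w - (m.c : ℂ) • m.J (adjoint m.J w) := by
      rw [← hv, hw, add_sub_cancel_right]
    have hk' : k = m.τ (adjoint m.J w) := by
      rw [← m.hasTrace_iff, ← hv]; exact hk
    rw [← h2, ← hv, ← hk'] at h1
    exact h1

theorem opNeumannTrace_unique (m : FormModel b V) {u : L2Dom Ω} {g g' : L2Bdry Ω}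
    (h : IsOpNeumannTrace b u g) (h' : IsOpNeumannTrace b u g') : g = g' := by
  obtain ⟨f, hf, h⟩ := m.isOpNeumannTrace_iff.1 h
  obtain ⟨f', hf', h'⟩ := m.isOpNeumannTrace_iff.1 h'
  obtain rfl := LinearPMap.mem_graph_snd_inj _ hf hf' rfl
  rw [← sub_eq_zero]
  refine m.denseRange_trace_neumannOp.eq_zero_of_inner_right ℂ fun w => ?_
  rw [inner_sub_right, ← h, ← h', sub_self]

theorem mem_opNeumann_graph_iff (m : FormModel b V) {u : L2Dom Ω} {g : L2Bdry Ω} :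
    (u, g) ∈ (opNeumann b).graph ↔ IsOpNeumannTrace b u g := by
  rw [opNeumann, Submodule.toLinearPMap_graph_eq]
  · rfl
  · rintro ⟨x, k⟩ hk (rfl : x = 0)
    exact m.opNeumannTrace_unique hk (opNeumannGraph b).zero_mem

/-- On the form domain the two Neumann traces agree, because `D(B_N)` is dense in the form norm and
all terms in the defining identity of `N^b` are continuous in that norm. -/
theorem isFormNeumannTrace_iff_isOpNeumannTrace (m : FormModel b V) {u : L2Dom Ω} {g : L2Bdry Ω} :
    IsFormNeumannTrace b u g ↔ u ∈ b.dom ∧ IsOpNeumannTrace b u g := by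
  have key : ∀ (x : V) (f w : L2Dom Ω), inner ℂ (m.J (adjoint m.J w)) f -
      inner ℂ (w - (m.c : ℂ) • m.J (adjoint m.J w)) (m.J x) =
        inner ℂ (m.J (adjoint m.J w)) f - inner ℂ (adjoint m.J w) x +
          m.c * inner ℂ (m.J (adjoint m.J w)) (m.J x) := by
    intro x f w
    rw [ContinuousLinearMap.adjoint_inner_left, inner_sub_left, inner_smul_left,
      Complex.conj_ofReal]
    ring
  constructor
  · intro h
    refine ⟨h.1, ?_⟩
    obtain ⟨x, rfl⟩ := (m.mem_dom_iff u).1 h.1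
    obtain ⟨f, hf, h⟩ := m.isFormNeumannTrace_iff.1 h
    refine m.isOpNeumannTrace_iff.2 ⟨f, hf, fun w => ?_⟩
    rw [key, h]
  · rintro ⟨hu, h⟩
    obtain ⟨x, rfl⟩ := (m.mem_dom_iff u).1 hu
    obtain ⟨f, hf, h⟩ := m.isOpNeumannTrace_iff.1 h
    refine m.isFormNeumannTrace_iff.2 ⟨f, hf, fun y => ?_⟩
    have hL : Continuous fun y => inner ℂ (m.J y) f - inner ℂ y x +
        m.c * inner ℂ (m.J y) (m.J x) := by fun_prop
    have hR : Continuous fun y => inner ℂ (m.τ y) g := by fun_prop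
    refine congrFun (DenseRange.equalizer m.denseRange_adjoint hL hR (funext fun w => ?_)) y
    have h1 := h w
    rw [key] at h1
    exact h1

/-- The kernel of `𝒩^b` is `D(B_N)`, because `B_N` is self-adjoint. -/
theorem isOpNeumannTrace_zero_iff (m : FormModel b V) (hs : b.IsSymm)
    (hd : Dense ((minimalOp b).domain : Set (L2Dom Ω))) {u : L2Dom Ω} :
    IsOpNeumannTrace b u 0 ↔ u ∈ (neumannOp b).domain := by
  rw [m.isOpNeumannTrace_iff, LinearPMap.mem_domain_iff]
  constructor
  · rintro ⟨f, -, h⟩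
    refine ⟨f, m.mem_neumannOp_graph_of_forall fun w => ?_⟩
    have h1 := h w
    rw [inner_zero_right] at h1
    linear_combination -h1
  · rintro ⟨f, hf⟩
    refine ⟨f, m.neumannOp_graph_le_maximalOp_graph hs hd hf, fun w => ?_⟩
    rw [inner_zero_right, m.neumannOp_symm hs (m.mem_neumannOp_graph w) hf, sub_self]

theorem isFormNeumannTrace_zero_iff (m : FormModel b V) (hs : b.IsSymm)
    (hd : Dense ((minimalOp b).domain : Set (L2Dom Ω))) {u : L2Dom Ω} :
    IsFormNeumannTrace b u 0 ↔ u ∈ (neumannOp b).domain := by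
  rw [m.isFormNeumannTrace_iff_isOpNeumannTrace, m.isOpNeumannTrace_zero_iff hs hd]
  exact and_iff_right_of_imp fun h => m.neumannOp_domain_le h

theorem formNeumann_eq_opNeumann_of_surjective (m : FormModel b V) (hs : b.IsSymm)
    (hd : Dense ((minimalOp b).domain : Set (L2Dom Ω)))
    (hsurj : ∀ g : L2Bdry Ω, ∃ u : (formNeumann b).domain, formNeumann b u = g) :
    formNeumann b = opNeumann b := by
  refine LinearPMap.eq_of_eq_graph (le_antisymm ?_ ?_)
  · rintro ⟨u, g⟩ h
    rw [m.mem_formNeumann_graph_iff, m.isFormNeumannTrace_iff_isOpNeumannTrace] at h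
    exact m.mem_opNeumann_graph_iff.2 h.2
  · rintro ⟨u, g⟩ h
    rw [m.mem_opNeumann_graph_iff] at h
    obtain ⟨w, rfl⟩ := hsurj g
    have hw := m.mem_formNeumann_graph_iff.1 ((formNeumann b).mem_graph w)
    -- The difference of two elements with the same Neumann trace lies in `D(B_N)`.
    have hdiff : IsOpNeumannTrace b (u - w) 0 := by
      have h1 : (u, formNeumann b w) ∈ opNeumannGraph b := h
      have h2 : ((w : L2Dom Ω), formNeumann b w) ∈ opNeumannGraph b :=
        (m.isFormNeumannTrace_iff_isOpNeumannTrace.1 hw).2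
      have h3 := (opNeumannGraph b).sub_mem h1 h2
      rwa [Prod.mk_sub_mk, sub_self] at h3
    rw [m.isOpNeumannTrace_zero_iff hs hd, ← m.isFormNeumannTrace_zero_iff hs hd] at hdiff
    have h4 : (u - w, (0 : L2Bdry Ω)) ∈ formNeumannGraph b := hdiff
    have h5 : ((w : L2Dom Ω), formNeumann b w) ∈ formNeumannGraph b := hw
    have hsum := (formNeumannGraph b).add_mem h4 h5
    rw [Prod.mk_add_mk, sub_add_cancel, zero_add] at hsum
    exact m.mem_formNeumann_graph_iff.2 hsum

end FormModel

end AbstractNeumann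

theorem mainTheorem3 {d : ℕ} (hd : 1 ≤ d) (Ω : Set (Eucl d))
    (hΩ : IsBoundedLipschitzDomain Ω)
    (b : SesqForm (L2Dom Ω))
    (hb : IsAdmissible b)
    (hdense : Dense (((dirichletOp b).domain ⊓ (neumannOp b).domain :
      Submodule ℂ (L2Dom Ω)) : Set (L2Dom Ω))) :
    -- (i) `B_0` is densely defined, symmetric, closed; `B_0 ⊆ B_0^*` and `B_0^{**} = B_0`
    (Dense ((minimalOp b).domain : Set (L2Dom Ω)) ∧
      (minimalOp b).IsFormalAdjoint (minimalOp b) ∧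
      (minimalOp b).IsClosed ∧
      Dense ((maximalOp b).domain : Set (L2Dom Ω)) ∧
      minimalOp b ≤ maximalOp b ∧
      (maximalOp b).adjoint = minimalOp b) ∧
    -- (ii) `tr (D(B_N))` is dense in `L²(Γ)`
    Dense {h : L2Bdry Ω |
      ∃ v ∈ (neumannOp b).domain, HasTrace Ω v h} ∧
    -- (iii) the traces are well defined, agree on `D(b)`, and have kernel `D(B_N)`
    ((∀ u ∈ b.dom, ∃! h, HasTrace Ω u h) ∧
      (∀ u g g', IsFormNeumannTrace b u g →
        IsFormNeumannTrace b u g' → g = g') ∧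
      (∀ u g g', IsOpNeumannTrace b u g →
        IsOpNeumannTrace b u g' → g = g') ∧
      (opNeumann b).domRestrict b.dom = formNeumann b ∧
      pker (formNeumann b) =
        (neumannOp b).domain ∧
      pker (opNeumann b) =
        (neumannOp b).domain ∧
      Dense ((formNeumann b).domain : Set (L2Dom Ω)) ∧
      Dense ((opNeumann b).domain : Set (L2Dom Ω))) ∧
    -- (iv) if `N^b` is surjective, the two traces coincide
    ((∀ g : L2Bdry Ω, ∃ u : (formNeumann b).domain,
        formNeumann b u = g) →
      formNeumann b = opNeumann b) := by
  obtain ⟨V, _, _, _, ⟨m⟩⟩ := hΩ.exists_formModel hb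
  have hs := hb.symm
  have hmin : Dense ((minimalOp b).domain : Set (L2Dom Ω)) := hdense
  have hle : minimalOp b ≤ maximalOp b :=
    LinearPMap.IsFormalAdjoint.le_adjoint hmin (m.minimalOp_isFormalAdjoint hs)
  have hmax : Dense ((maximalOp b).domain : Set (L2Dom Ω)) := hmin.mono hle.1
  have hN : Dense ((neumannOp b).domain : Set (L2Dom Ω)) := hdense.mono inf_le_right
  have hform : (neumannOp b).domain ≤ (formNeumann b).domain := fun u hu =>
    LinearPMap.mem_domain_of_mem_graph
      (m.mem_formNeumann_graph_iff.2 ((m.isFormNeumannTrace_zero_iff hs hmin).2 hu))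
  have hop : (neumannOp b).domain ≤ (opNeumann b).domain := fun u hu =>
    LinearPMap.mem_domain_of_mem_graph
      (m.mem_opNeumann_graph_iff.2 ((m.isOpNeumannTrace_zero_iff hs hmin).2 hu))
  refine ⟨⟨hmin, m.minimalOp_isFormalAdjoint hs, m.minimalOp_isClosed, hmax, hle, ?_⟩, ?_,
    ⟨fun u hu => hΩ.existsUnique_hasTrace hb hu, fun _ _ _ h h' => m.formNeumannTrace_unique h h',
      fun _ _ _ h h' => m.opNeumannTrace_unique h h', ?_, ?_, ?_, hN.mono hform, hN.mono hop⟩,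
    m.formNeumann_eq_opNeumann_of_surjective hs hmin⟩
  · refine LinearPMap.eq_of_eq_graph ?_
    rw [LinearPMap.adjoint_graph_eq_graph_adjoint hmax, maximalOp,
      LinearPMap.adjoint_graph_eq_graph_adjoint hmin,
      Submodule.adjoint_adjoint_of_isClosed m.minimalOp_isClosed]
  · refine m.denseRange_trace_neumannOp.mono ?_
    rintro _ ⟨w, rfl⟩
    exact ⟨_, LinearPMap.mem_domain_of_mem_graph (m.mem_neumannOp_graph w),
      (m.hasTrace_iff _ _).2 rfl⟩
  · refine LinearPMap.eq_of_eq_graph (Submodule.ext ?_)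
    rintro ⟨u, g⟩
    rw [mem_graph_domRestrict_iff, m.mem_opNeumann_graph_iff, m.mem_formNeumann_graph_iff,
      m.isFormNeumannTrace_iff_isOpNeumannTrace]
  · ext u
    rw [mem_pker_iff, m.mem_formNeumann_graph_iff, m.isFormNeumannTrace_zero_iff hs hmin]
  · ext u
    rw [mem_pker_iff, m.mem_opNeumann_graph_iff, m.isOpNeumannTrace_zero_iff hs hmin]
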